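/- Let $d\ge 1$ be an integer, let $1<p<2$, and let $p'=p/(p-1)$. Let $\mathbb{T}^d=(\mathbb{R}/\mathbb{Z})^d$ carry the normalized Haar measure, and let $L^p(\mathbb{T}^d)$ be the space of complex-valued $p$-integrable functions on it. For $0<s,r<\infty$ let $\ell^{s,r}(\mathbb{Z}^d)$ be the space of all $a=(a_k)_{k\in\mathbb{Z}^d}\subset\mathbb{C}$ with $$\|a\|_{s,r}=s^{1/r}\left(\int_0^\infty t^{r-1}\,\#\{k\in\mathbb{Z}^d:|a_k|>t\}^{r/s}\,dt\right)^{1/r}<\infty .$$ Then the discrete Fourier transform $$\mathcal{F}f=\big(\widehat f(k)\big)_{k\in\mathbb{Z}^d},\qquad \widehat f(k)=\int_{\mathbb{T}^d}f(x)\,e^{-2\pi i\,k\cdot x}\,dx,$$ is a bounded linear operator from $L^p(\mathbb{T}^d)$ into $\ell^{p',p}(\mathbb{Z}^d)$: it maps $L^p(\mathbb{T}^d)$ linearly into $\ell^{p',p}(\mathbb{Z}^d)$, and there is a constant $C$ with $\|\mathcal{F}f\|_{p',p}\le C\|f\|_{L^p}$ for all $f\in L^p(\mathbb{T}^d)$.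 However, $\mathcal{F}$ is not strictly singular: there is an infinite-dimensional linear subspace $Z\subseteq L^p(\mathbb{T}^d)$ such that the restriction of $\mathcal{F}$ to $Z$ is an isomorphism from $Z$ onto $\mathcal{F}(Z)$, i.e. there are constants $0<c\le C'<\infty$ with $c\|f\|_{L^p}\le\|\mathcal{F}f\|_{p',p}\le C'\|f\|_{L^p}$ for all $f\in Z$. -/

import Mathlib

open MeasureTheory

noncomputable section

/-- The Lorentz functional
`‖f‖_{L^{p,r}(μ)} = p^{1/r} (∫_0^∞ t^{r-1} μ{x : |f(x)| > t}^{r/p} dt)^{1/r}`, with values in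
`[0, ∞]`, for finite exponents `0 < p` and `0 < r`. -/
def eLorentzNorm {α : Type*} [MeasurableSpace α] (f : α → ℂ) (p r : ℝ) (μ : Measure α) :
    ENNReal :=
  ENNReal.ofReal (p ^ (1 / r)) *
    (∫⁻ t in Set.Ioi (0 : ℝ),
      ENNReal.ofReal (t ^ (r - 1)) * μ {x | t < ‖f x‖} ^ (r / p)) ^ (1 / r)

theorem eLorentzNorm_lt_top_iff {α : Type*} [MeasurableSpace α] (f : α → ℂ) {p r : ℝ}
    (hp : 0 < p) (hr : 0 < r) (μ : Measure α) :
    eLorentzNorm f p r μ < ⊤ ↔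
      ∫⁻ t in Set.Ioi (0 : ℝ),
        ENNReal.ofReal (t ^ (r - 1)) * μ {x | t < ‖f x‖} ^ (r / p) < ⊤ := by
  have h1 : ENNReal.ofReal (p ^ (1 / r)) ≠ 0 := by
    simpa using Real.rpow_pos_of_pos hp _
  have h2 : 0 < 1 / r := by positivity
  rw [eLorentzNorm]
  conv_rhs => rw [← ENNReal.rpow_lt_top_iff_of_pos h2]
  constructor
  · intro h
    exact ENNReal.lt_top_of_mul_ne_top_right h.ne h1
  · intro h
    exact ENNReal.mul_lt_top ENNReal.ofReal_lt_top h

theorem lintegral_lorentz_scale {r K : ℝ} (hK : 0 < K) (G : ℝ → ENNReal) (hG : Antitone G) :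
    ∫⁻ t in Set.Ioi (0 : ℝ), ENNReal.ofReal (t ^ (r - 1)) * G (K * t) =
      ENNReal.ofReal (K ^ (-r)) *
        ∫⁻ t in Set.Ioi (0 : ℝ), ENNReal.ofReal (t ^ (r - 1)) * G t := by
  have himg : (fun t : ℝ => K * t) '' Set.Ioi 0 = Set.Ioi 0 := by
    ext x
    constructor
    · rintro ⟨t, ht, rfl⟩
      exact mul_pos hK ht
    · intro hx
      exact ⟨x / K, div_pos hx hK, by field_simp⟩
  have hcv := lintegral_image_eq_lintegral_abs_deriv_mul (s := Set.Ioi (0 : ℝ))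
    (f := fun t => K * t) (f' := fun _ => K) measurableSet_Ioi
    (fun x _ => by simpa using ((hasDerivAt_id x).const_mul K).hasDerivWithinAt)
    (fun x _ y _ h => mul_left_cancel₀ hK.ne' h)
    (fun t => ENNReal.ofReal (t ^ (r - 1)) * G t)
  rw [himg] at hcv
  rw [hcv, ← lintegral_const_mul]
  · refine setLIntegral_congr_fun measurableSet_Ioi fun t ht => ?_
    have ht : 0 < t := ht
    rw [Real.mul_rpow hK.le ht.le, ENNReal.ofReal_mul (by positivity), abs_of_pos hK,
      ← mul_assoc, ← mul_assoc, ← mul_assoc, ← ENNReal.ofReal_mul (by positivity),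
      ← ENNReal.ofReal_mul (by positivity)]
    have : K ^ (-r) * K * K ^ (r - 1) = 1 := by
      rw [← Real.rpow_add_one hK.ne', ← Real.rpow_add hK]
      simp
    rw [this, ENNReal.ofReal_one, one_mul]
  · have := hG.measurable
    fun_prop

/-- The Lorentz sequence space `ℓ^{p,r}(ι)`, i.e. the Lorentz space of the counting measure on
`ι`, for finite exponents `0 < p` and `0 < r`. -/
def lorentzSeq (ι : Type*) [MeasurableSpace ι] (p r : ℝ) (hp : 0 < p) (hr : 0 < r) :
    Submodule ℂ (ι → ℂ) where
  carrier := {a | eLorentzNorm a p r Measure.count < ⊤}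
  zero_mem' := by
    have : ∀ t ∈ Set.Ioi (0 : ℝ), ENNReal.ofReal (t ^ (r - 1)) *
        (Measure.count : Measure ι) {x | t < ‖(0 : ι → ℂ) x‖} ^ (r / p) = 0 := by
      intro t ht
      have ht : 0 < t := ht
      simp [not_lt.2 ht.le, ENNReal.zero_rpow_of_pos (div_pos hr hp)]
    rw [Set.mem_ofPred_eq, eLorentzNorm_lt_top_iff _ hp hr,
      setLIntegral_congr_fun measurableSet_Ioi this]
    simp
  add_mem' := by
    intro a b ha hb
    rw [Set.mem_ofPred_eq, eLorentzNorm_lt_top_iff _ hp hr] at ha hb ⊢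
    have hs : 0 < r / p := div_pos hr hp
    let D : (ι → ℂ) → ℝ → ENNReal := fun f t =>
      (Measure.count : Measure ι) {x | t < ‖f x‖} ^ (r / p)
    have hD : ∀ f, Antitone (D f) := fun f s t hst =>
      ENNReal.rpow_le_rpow (measure_mono fun x hx => lt_of_le_of_lt hst hx) hs.le
    have hfin : ∀ f, ∫⁻ t in Set.Ioi (0 : ℝ), ENNReal.ofReal (t ^ (r - 1)) * D f t < ⊤ →
        ∫⁻ t in Set.Ioi (0 : ℝ), ENNReal.ofReal (t ^ (r - 1)) * D f (1 / 2 * t) < ⊤ := by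
      intro f hf
      rw [lintegral_lorentz_scale (by norm_num) _ (hD f)]
      exact ENNReal.mul_lt_top ENNReal.ofReal_lt_top hf
    have key : ∀ t, D (a + b) t ≤ 2 ^ (r / p) * (D a (1 / 2 * t) + D b (1 / 2 * t)) := by
      intro t
      have h1 : (Measure.count : Measure ι) {x | t < ‖(a + b) x‖} ≤
          2 * max ((Measure.count : Measure ι) {x | 1 / 2 * t < ‖a x‖})
            ((Measure.count : Measure ι) {x | 1 / 2 * t < ‖b x‖}) := by
        rw [two_mul]
        refine (measure_mono ?_).trans ((measure_union_le {x | 1 / 2 * t < ‖a x‖}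
          {x | 1 / 2 * t < ‖b x‖}).trans (add_le_add (le_max_left _ _) (le_max_right _ _)))
        intro x hx
        by_contra hcon
        simp only [Set.mem_union, Set.mem_ofPred_eq, not_or, not_lt] at hcon hx
        have := norm_add_le (a x) (b x)
        simp only [Pi.add_apply] at hx
        linarith [hcon.1, hcon.2]
      refine (ENNReal.rpow_le_rpow h1 hs.le).trans ?_
      rw [ENNReal.mul_rpow_of_nonneg _ _ hs.le]
      gcongr
      rw [(ENNReal.monotone_rpow_of_nonneg hs.le).map_max]
      exact max_le le_self_add le_add_self
    have hm : ∀ f, Measurable fun t : ℝ =>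
        ENNReal.ofReal (t ^ (r - 1)) * D f (1 / 2 * t) := by
      intro f
      have := (hD f).measurable
      fun_prop
    calc _ ≤ ∫⁻ t in Set.Ioi (0 : ℝ), 2 ^ (r / p) *
          (ENNReal.ofReal (t ^ (r - 1)) * D a (1 / 2 * t) +
            ENNReal.ofReal (t ^ (r - 1)) * D b (1 / 2 * t)) := by
          refine lintegral_mono fun t => ?_
          rw [← mul_add, mul_left_comm]
          exact mul_le_mul_right (key t) _
      _ < ⊤ := by
          rw [lintegral_const_mul' _ _ (by finiteness), lintegral_add_left (hm a)]
          exact ENNReal.mul_lt_top (by finiteness)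
            (ENNReal.add_lt_top.2 ⟨hfin a ha, hfin b hb⟩)
  smul_mem' := by
    intro c a ha
    rw [Set.mem_ofPred_eq, eLorentzNorm_lt_top_iff _ hp hr] at ha ⊢
    have hs : 0 < r / p := div_pos hr hp
    let D : ℝ → ENNReal := fun t => (Measure.count : Measure ι) {x | t < ‖a x‖} ^ (r / p)
    have hD : Antitone D := fun s t hst =>
      ENNReal.rpow_le_rpow (measure_mono fun x hx => lt_of_le_of_lt hst hx) hs.le
    have hc : 0 < ‖c‖ + 1 := by positivity
    calc _ ≤ ∫⁻ t in Set.Ioi (0 : ℝ),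
          ENNReal.ofReal (t ^ (r - 1)) * D ((‖c‖ + 1)⁻¹ * t) := by
          refine lintegral_mono fun t => ?_
          refine mul_le_mul_right (ENNReal.rpow_le_rpow (measure_mono fun x hx => ?_) hs.le) _
          simp only [Set.mem_ofPred_eq, Pi.smul_apply, smul_eq_mul, norm_mul] at hx ⊢
          rw [inv_mul_lt_iff₀ hc]
          nlinarith [norm_nonneg (a x)]
      _ < ⊤ := by
          rw [lintegral_lorentz_scale (by positivity) _ hD]
          exact ENNReal.mul_lt_top ENNReal.ofReal_lt_top ha

/-- The (quasi-)norm of `ℓ^{p,r}(ι)`. -/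
instance lorentzSeq.instNorm (ι : Type*) [MeasurableSpace ι] (p r : ℝ) (hp : 0 < p)
    (hr : 0 < r) : Norm (lorentzSeq ι p r hp hr) :=
  ⟨fun a => (eLorentzNorm (a : ι → ℂ) p r Measure.count).toReal⟩

/-- A linear map between (quasi-)normed spaces is bounded. -/
def IsBoundedOperator {X Y : Type*} [AddCommGroup X] [Module ℂ X] [Norm X]
    [AddCommGroup Y] [Module ℂ Y] [Norm Y] (T : X →ₗ[ℂ] Y) : Prop :=
  ∃ C : ℝ, ∀ x, ‖T x‖ ≤ C * ‖x‖

/-- A linear map between (quasi-)normed spaces is strictly singular if there is no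
infinite-dimensional subspace `Z` of its domain such that the restriction of `T` to `Z` is an
isomorphism from `Z` onto `T(Z)`, that is, such that `‖T z‖` and `‖z‖` are equivalent on `Z`. -/
def IsStrictlySingular {X Y : Type*} [AddCommGroup X] [Module ℂ X] [Norm X]
    [AddCommGroup Y] [Module ℂ Y] [Norm Y] (T : X →ₗ[ℂ] Y) : Prop :=
  ¬ ∃ Z : Submodule ℂ X, ¬ FiniteDimensional ℂ Z ∧
    ∃ c C : ℝ, 0 < c ∧ 0 < C ∧ ∀ z ∈ Z, c * ‖z‖ ≤ ‖T z‖ ∧ ‖T z‖ ≤ C * ‖z‖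

/-- The normalized Haar measure of the torus `𝕋^d = (ℝ/ℤ)^d`. -/
abbrev torusMeasure (d : ℕ) : Measure (UnitAddTorus (Fin d)) :=
  Measure.pi fun _ => AddCircle.haarAddCircle

/-- The discrete Fourier transform sends `f` to its family of Fourier coefficients
`k ↦ ∫_{𝕋^d} f(x) e^{-2πi k·x} dx`, `k ∈ ℤ^d`; the integral is with respect to normalized Haar
measure. -/
theorem mFourierCoeff_eq_integral_torusMeasure {d : ℕ} (f : UnitAddTorus (Fin d) → ℂ)
    (k : Fin d → ℤ) :
    UnitAddTorus.mFourierCoeff f k =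
      ∫ x, UnitAddTorus.mFourier (-k) x • f x ∂(torusMeasure d) := rfl

end

open UnitAddTorus

/-! Boundedness is Paley's inequality. Rank the coefficients by decreasing modulus, with ranks `n
k`. Give the frequency `k` the mass `(n k)⁻²`. The map sending `f` to the sequence `n k * f̂(k)` is
then of weak type (1,1), because the tail of `∑ m⁻²` beyond `s` is at most `2 / s`, and of type
(2,2) by Bessel. Marcinkiewicz interpolation bounds `∑ (n k)^(p-2) |f̂(k)|^p` by a multiple of
`‖f‖_p^p` (`sum_rank_rpow_mul_norm_mFourierCoeff_le`). The bound is uniform in the injective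
ranking, so the ranking may depend on `f`. Since `p / q = p - 1`, this sum controls the Lorentz
integral (`lintegral_card_filter_rpow_le`).

Strict singularity fails because the second Lorentz index is `p`: both spaces contain `ℓ^p`, and the
transform carries one copy onto another. Take `L^p`-normalized indicators of disjoint slabs of width
`h_n = 1 / (4 N_n)`, with `N_n` growing very fast; they span `ℓ^p` in `L^p`. On the `N_n`
frequencies `j e_i` with `N_n < j ≤ 2 N_n`, the `n`-th transform has size about `h_n^(1/q)`, while
the others contribute a small rank-one perturbation (`norm_mFourierCoeff_slabFun_le`,
`sum_rpow_le_four_mul_sum_perturb`). Block `n` therefore adds about `(N_n h_n)^(p-1) |a n|^p`, a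
fixed multiple of `|a n|^p`, to the Lorentz integral. Lacunarity of `N_n` makes these contributions
add up (`sum_block_le_lintegral`). -/

/-! ### Ranks and layer-cake integrals -/

/-- Insert the elements in decreasing order of `a`, so that the newest one takes the last rank. Ties
are broken arbitrarily, hence an upper bound on `n k` and not an equality; this is the direction
needed, because ranks enter with the negative exponent `p - 2`. -/
theorem exists_injOn_rank {ι : Type*} [DecidableEq ι] (S : Finset ι) (a : ι → ℝ) :
    ∃ n : ι → ℕ, Set.InjOn n S ∧ ∀ k ∈ S, 1 ≤ n k ∧ n k ≤ (S.filter fun j => a k ≤ a j).card := by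
  induction S using Finset.induction_on_min_value (f := a) with
  | empty => exact ⟨fun _ => 0, by simp, by simp⟩
  | insert i s hi hmin ih =>
    obtain ⟨n, hinj, hn⟩ := ih
    have hlt : ∀ k ∈ s, n k ≤ s.card := fun k hk =>
      (hn k hk).2.trans (Finset.card_filter_le _ _)
    have hne : ∀ k ∈ s, k ≠ i := fun k hk h => hi (h ▸ hk)
    refine ⟨Function.update n i (s.card + 1), ?_, ?_⟩
    · intro x hx y hy hxy
      simp only [Finset.coe_insert, Set.mem_insert_iff, Finset.mem_coe] at hx hy
      rcases hx with rfl | hx <;> rcases hy with rfl | hy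
      · rfl
      · rw [Function.update_self, Function.update_of_ne (hne y hy)] at hxy
        have := hlt y hy
        omega
      · rw [Function.update_self, Function.update_of_ne (hne x hx)] at hxy
        have := hlt x hx
        omega
      · rw [Function.update_of_ne (hne x hx), Function.update_of_ne (hne y hy)] at hxy
        exact hinj hx hy hxy
    · intro k hk
      rcases Finset.mem_insert.1 hk with rfl | hk
      · rw [Function.update_self, Finset.filter_true_of_mem, Finset.card_insert_of_notMem hi]
        · omega
        · intro j hj
          rcases Finset.mem_insert.1 hj with rfl | hj
          · exact le_rfl
          · exact hmin j hj
      · rw [Function.update_of_ne (hne k hk)]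
        exact ⟨(hn k hk).1, (hn k hk).2.trans (Finset.card_le_card
          (Finset.filter_subset_filter _ (Finset.subset_insert _ _)))⟩

/-- Injectivity of `n` reduces this to a tail of `∑ m⁻²`. It is the source of the weak (1,1) bound.
-/
theorem sum_inv_sq_filter_lt_le {ι : Type*} {S : Finset ι} {n : ι → ℕ} (hn : Set.InjOn n S)
    {s : ℝ} (hs : 0 < s) :
    ∑ k ∈ S with s < n k, ((n k : ℝ) ^ 2)⁻¹ ≤ 2 / s := by
  classical
  have hinj : Set.InjOn n (S.filter fun k => s < n k) :=
    hn.mono (Finset.coe_subset.2 (Finset.filter_subset _ _))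
  rw [← Finset.sum_image (f := fun m : ℕ => ((m : ℝ) ^ 2)⁻¹) hinj]
  calc _ ≤ ∑ m ∈ Finset.Ioo ⌊s⌋₊ (S.sup n + 1), ((m : ℝ) ^ 2)⁻¹ := by
        refine Finset.sum_le_sum_of_subset_of_nonneg ?_ fun _ _ _ => by positivity
        intro m hm
        obtain ⟨k, hk, rfl⟩ := Finset.mem_image.1 hm
        obtain ⟨hk, hsk⟩ := Finset.mem_filter.1 hk
        exact Finset.mem_Ioo.2 ⟨(Nat.floor_lt hs.le).2 hsk, Nat.lt_succ_of_le (Finset.le_sup hk)⟩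
    _ ≤ 2 / (⌊s⌋₊ + 1) := sum_Ioo_inv_sq_le _ _
    _ ≤ 2 / s := by
        gcongr
        exact (Nat.lt_floor_add_one s).le

theorem lintegral_rpow_mul_indicator_Iio {p : ℝ} (hp : 0 < p) {y : ℝ} (hy : 0 ≤ y) :
    ∫⁻ t in Set.Ioi (0 : ℝ), ENNReal.ofReal (t ^ (p - 1)) * (Set.Iio y).indicator 1 t =
      ENNReal.ofReal (y ^ p / p) := by
  have h1 : ∀ t : ℝ, ENNReal.ofReal (t ^ (p - 1)) * (Set.Iio y).indicator 1 t =
      (Set.Iio y).indicator (fun t => ENNReal.ofReal (t ^ (p - 1))) t := by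
    intro t
    by_cases ht : t ∈ Set.Iio y <;> simp [ht]
  simp_rw [h1]
  rw [lintegral_indicator measurableSet_Iio, Measure.restrict_restrict measurableSet_Iio,
    Set.inter_comm, Set.Ioi_inter_Iio, restrict_Ioo_eq_restrict_Ioc]
  have hint := intervalIntegral.intervalIntegrable_rpow' (a := 0) (b := y) (r := p - 1) (by linarith)
  rw [intervalIntegrable_iff_integrableOn_Ioc_of_le hy] at hint
  rw [← ofReal_integral_eq_lintegral_ofReal hint, ← intervalIntegral.integral_of_le hy,
    integral_rpow (Or.inl (by linarith))]
  · simp [Real.zero_rpow hp.ne']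
  · filter_upwards [ae_restrict_mem measurableSet_Ioc] with t ht
    exact Real.rpow_nonneg ht.1.le _

theorem lintegral_rpow_mul_indicator_Ici {s : ℝ} (hs : 0 < s) {y : ℝ} (hy : 0 < y) :
    ∫⁻ t in Set.Ioi (0 : ℝ), ENNReal.ofReal (t ^ (-s - 1)) * (Set.Ici y).indicator 1 t =
      ENNReal.ofReal (y ^ (-s) / s) := by
  have h1 : ∀ t : ℝ, ENNReal.ofReal (t ^ (-s - 1)) * (Set.Ici y).indicator 1 t =
      (Set.Ici y).indicator (fun t => ENNReal.ofReal (t ^ (-s - 1))) t := by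
    intro t
    by_cases ht : t ∈ Set.Ici y <;> simp [ht]
  simp_rw [h1]
  rw [lintegral_indicator measurableSet_Ici, Measure.restrict_restrict measurableSet_Ici,
    Set.inter_eq_left.2 (Set.Ici_subset_Ioi.2 hy),
    Measure.restrict_congr_set Ioi_ae_eq_Ici.symm]
  rw [← ofReal_integral_eq_lintegral_ofReal (integrableOn_Ioi_rpow_of_lt (by linarith) hy),
    integral_Ioi_rpow_of_lt (by linarith) hy]
  · congr 1
    rw [sub_add_cancel, neg_div, div_neg, neg_neg]
  · filter_upwards [ae_restrict_mem measurableSet_Ioi] with t ht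
    exact Real.rpow_nonneg (hy.trans ht).le _

/-- A finite family with a decreasing rank function has Lorentz integral controlled by its
rank-weighted `p`-th power sum. -/
theorem lintegral_card_filter_rpow_le {ι : Type*} {S : Finset ι} {a : ι → ℝ} {n : ι → ℕ}
    (ha : ∀ k, 0 ≤ a k)
    (hn : ∀ k ∈ S, 1 ≤ n k ∧ n k ≤ (S.filter fun j => a k ≤ a j).card) {p : ℝ} (hp1 : 1 < p)
    (hp2 : p < 2) :
    ∫⁻ t in Set.Ioi (0 : ℝ), ENNReal.ofReal (t ^ (p - 1)) *
        ((S.filter fun k => t < a k).card : ENNReal) ^ (p - 1) ≤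
      ENNReal.ofReal (1 / p) * ∑ k ∈ S, ENNReal.ofReal ((n k : ℝ) ^ (p - 2) * a k ^ p) := by
  have key : ∀ t : ℝ, ((S.filter fun k => t < a k).card : ENNReal) ^ (p - 1) ≤
      ∑ k ∈ S, ENNReal.ofReal ((n k : ℝ) ^ (p - 2)) * (Set.Iio (a k)).indicator 1 t := by
    intro t
    set W := (S.filter fun k => t < a k).card with hW
    have h1 : ∑ k ∈ S, ENNReal.ofReal ((n k : ℝ) ^ (p - 2)) * (Set.Iio (a k)).indicator 1 t =
        ∑ k ∈ S with t < a k, ENNReal.ofReal ((n k : ℝ) ^ (p - 2)) := by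
      rw [Finset.sum_filter]
      refine Finset.sum_congr rfl fun k _ => ?_
      by_cases h : t < a k <;> simp [h]
    rw [h1]
    rcases Nat.eq_zero_or_pos W with h0 | h0
    · rw [h0, Nat.cast_zero, ENNReal.zero_rpow_of_pos (by linarith)]
      exact zero_le
    -- An index with `a k > t` has rank at most `W`, so each of the `W` terms is at least `W^(p-2)`,
    -- and together they give `W^(p-1)`.
    have h2 : ∀ k ∈ S.filter (fun k => t < a k),
        ENNReal.ofReal ((W : ℝ) ^ (p - 2)) ≤ ENNReal.ofReal ((n k : ℝ) ^ (p - 2)) := by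
      intro k hk
      obtain ⟨hk, hkt⟩ := Finset.mem_filter.1 hk
      refine ENNReal.ofReal_le_ofReal (Real.rpow_le_rpow_of_nonpos ?_ ?_ (by linarith))
      · exact_mod_cast (hn k hk).1
      · refine Nat.cast_le.2 ((hn k hk).2.trans (Finset.card_le_card ?_))
        intro j hj
        rw [Finset.mem_filter] at hj ⊢
        exact ⟨hj.1, hkt.trans_le hj.2⟩
    refine le_trans (le_of_eq ?_) (Finset.card_nsmul_le_sum _ _ _ h2)
    have hWr : (0 : ℝ) < W := by exact_mod_cast h0
    rw [nsmul_eq_mul, ← hW, ← ENNReal.ofReal_natCast, ENNReal.ofReal_rpow_of_pos hWr,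
      ← ENNReal.ofReal_mul hWr.le]
    congr 1
    rw [show p - 1 = 1 + (p - 2) by ring, Real.rpow_add hWr, Real.rpow_one]
  have hp : 0 < p := by linarith
  calc _ ≤ ∫⁻ t in Set.Ioi (0 : ℝ), ∑ k ∈ S, ENNReal.ofReal ((n k : ℝ) ^ (p - 2)) *
        (ENNReal.ofReal (t ^ (p - 1)) * (Set.Iio (a k)).indicator 1 t) := by
        refine lintegral_mono fun t => ?_
        refine (mul_le_mul_right (key t) _).trans (le_of_eq ?_)
        rw [Finset.mul_sum]
        exact Finset.sum_congr rfl fun k _ => mul_left_comm _ _ _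
    _ = ∑ k ∈ S, ENNReal.ofReal ((n k : ℝ) ^ (p - 2)) * ENNReal.ofReal (a k ^ p / p) := by
        have hm : ∀ k, Measurable fun t : ℝ =>
            ENNReal.ofReal (t ^ (p - 1)) * (Set.Iio (a k)).indicator (1 : ℝ → ENNReal) t :=
          fun k => Measurable.mul (by fun_prop) (measurable_one.indicator measurableSet_Iio)
        rw [lintegral_finsetSum _ fun k _ => (hm k).const_mul _]
        refine Finset.sum_congr rfl fun k _ => ?_
        rw [lintegral_const_mul _ (hm k), lintegral_rpow_mul_indicator_Iio hp (ha k)]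
    _ ≤ _ := by
        rw [Finset.mul_sum]
        refine Finset.sum_le_sum fun k _ => le_of_eq ?_
        rw [← ENNReal.ofReal_mul (by positivity), ← ENNReal.ofReal_mul (by positivity)]
        congr 1
        ring

/-! ### Fourier coefficients on the torus: linearity, the trivial bound, Bessel -/

theorem norm_mFourier_apply {d : ℕ} (k : Fin d → ℤ) (x : UnitAddTorus (Fin d)) :
    ‖mFourier k x‖ = 1 := by
  simp only [mFourier, ContinuousMap.coe_mk, norm_prod, fourier_apply]
  exact Finset.prod_eq_one fun _ _ => Circle.norm_coe _

theorem integrable_mFourier_smul {d : ℕ} {f : UnitAddTorus (Fin d) → ℂ}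
    (hf : Integrable f (torusMeasure d)) (k : Fin d → ℤ) :
    Integrable (fun x => mFourier k x • f x) (torusMeasure d) :=
  hf.bdd_smul 1 (mFourier k).continuous.aestronglyMeasurable
    (Filter.Eventually.of_forall fun x => (norm_mFourier_apply k x).le)

theorem mFourierCoeff_add {d : ℕ} {f g : UnitAddTorus (Fin d) → ℂ}
    (hf : Integrable f (torusMeasure d)) (hg : Integrable g (torusMeasure d)) (k : Fin d → ℤ) :
    mFourierCoeff (f + g) k = mFourierCoeff f k + mFourierCoeff g k := by
  simp_rw [mFourierCoeff_eq_integral_torusMeasure]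
  rw [← integral_add (integrable_mFourier_smul hf _) (integrable_mFourier_smul hg _)]
  simp [mul_add]

theorem mFourierCoeff_const_smul {d : ℕ} (c : ℂ) (f : UnitAddTorus (Fin d) → ℂ)
    (k : Fin d → ℤ) : mFourierCoeff (c • f) k = c • mFourierCoeff f k := by
  simp_rw [mFourierCoeff_eq_integral_torusMeasure]
  rw [← integral_smul]
  simp [mul_left_comm]

theorem mFourierCoeff_congr_ae {d : ℕ} {f g : UnitAddTorus (Fin d) → ℂ}
    (h : f =ᵐ[torusMeasure d] g) : mFourierCoeff f = mFourierCoeff g := by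
  ext k
  simp_rw [mFourierCoeff_eq_integral_torusMeasure]
  refine integral_congr_ae ?_
  filter_upwards [h] with x hx
  rw [hx]

theorem norm_mFourierCoeff_le {d : ℕ} (f : UnitAddTorus (Fin d) → ℂ) (k : Fin d → ℤ) :
    ‖mFourierCoeff f k‖ ≤ ∫ x, ‖f x‖ ∂(torusMeasure d) := by
  rw [mFourierCoeff_eq_integral_torusMeasure]
  refine (norm_integral_le_integral_norm _).trans (le_of_eq ?_)
  simp [norm_mFourier_apply]

/-- Bessel's inequality on the torus. -/
theorem sum_sq_norm_mFourierCoeff_le {d : ℕ} {f : UnitAddTorus (Fin d) → ℂ}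
    (hf : MemLp f 2 (torusMeasure d)) (S : Finset (Fin d → ℤ)) :
    ∑ k ∈ S, ‖mFourierCoeff f k‖ ^ 2 ≤ ∫ x, ‖f x‖ ^ 2 ∂(torusMeasure d) := by
  have h := hasSum_sq_mFourierCoeff (d := Fin d) (hf.toLp f)
  rw [mFourierCoeff_congr_ae hf.coeFn_toLp] at h
  refine (sum_le_hasSum S (fun _ _ => by positivity) h).trans (le_of_eq ?_)
  refine integral_congr_ae ?_
  filter_upwards [hf.coeFn_toLp] with x hx
  rw [hx]

/-! ### Paley's inequality by real interpolation -/

/-- Restricted to the large values of `f`, the rank-weighted Fourier transform is of weak type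
`(1, 1)`; restricted to the small values it is of strong type `(2, 2)`. -/
theorem sum_inv_sq_rank_le {d : ℕ} {f : UnitAddTorus (Fin d) → ℂ} (hfm : StronglyMeasurable f)
    (hf : Integrable f (torusMeasure d)) {S : Finset (Fin d → ℤ)} {n : (Fin d → ℤ) → ℕ}
    (hn : Set.InjOn n S) (hn1 : ∀ k ∈ S, 1 ≤ n k) {t : ℝ} (ht : 0 < t) :
    ∑ k ∈ S with t < n k * ‖mFourierCoeff f k‖, ENNReal.ofReal ((n k : ℝ) ^ 2)⁻¹ ≤
      ENNReal.ofReal (4 / t) * ∫⁻ x in {x | t < ‖f x‖}, ‖f x‖ₑ ∂(torusMeasure d) +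
      ENNReal.ofReal (4 / t ^ 2) *
        ∫⁻ x in {x | t < ‖f x‖}ᶜ, ‖f x‖ₑ ^ 2 ∂(torusMeasure d) := by
  set E : Set (UnitAddTorus (Fin d)) := {x | t < ‖f x‖} with hE
  have hEm : MeasurableSet E := measurableSet_lt measurable_const hfm.norm.measurable
  set f₁ := E.indicator f with hf₁
  set f₂ := Eᶜ.indicator f with hf₂
  have hi₁ : Integrable f₁ (torusMeasure d) := hf.indicator hEm
  have hi₂ : Integrable f₂ (torusMeasure d) := hf.indicator hEm.compl
  have hsum : f = f₁ + f₂ := (Set.indicator_self_add_compl E f).symm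
  have hm₂ : MemLp f₂ 2 (torusMeasure d) := by
    refine MemLp.of_bound (hfm.indicator hEm.compl).aestronglyMeasurable t
      (Filter.Eventually.of_forall fun x => ?_)
    by_cases hx : x ∈ E
    · simp [hf₂, hx, ht.le]
    · rw [hf₂, Set.indicator_of_mem (show x ∈ Eᶜ from hx)]
      exact not_lt.1 hx
  set A := ∫ x, ‖f₁ x‖ ∂(torusMeasure d) with hA
  set B := ∫ x, ‖f₂ x‖ ^ 2 ∂(torusMeasure d) with hB
  have hA0 : 0 ≤ A := integral_nonneg fun _ => norm_nonneg _
  have hAe : ENNReal.ofReal A = ∫⁻ x in E, ‖f x‖ₑ ∂(torusMeasure d) := by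
    rw [hA, ofReal_integral_norm_eq_lintegral_enorm hi₁, ← lintegral_indicator hEm]
    simp_rw [hf₁, enorm_indicator_eq_indicator_enorm]
  have hBe : ENNReal.ofReal B = ∫⁻ x in Eᶜ, ‖f x‖ₑ ^ 2 ∂(torusMeasure d) := by
    rw [hB, ofReal_integral_eq_lintegral_ofReal hm₂.integrable_norm_pow'
      (Filter.Eventually.of_forall fun x => by positivity), ← lintegral_indicator hEm.compl]
    refine lintegral_congr fun x => ?_
    rw [ENNReal.ofReal_pow (norm_nonneg _), ofReal_norm, hf₂]
    by_cases hx : x ∈ E <;> simp [hx]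
  rw [← hAe, ← hBe, ← ENNReal.ofReal_mul (by positivity), ← ENNReal.ofReal_mul (by positivity),
    ← ENNReal.ofReal_add (by positivity) (by positivity),
    ← ENNReal.ofReal_sum_of_nonneg fun _ _ => by positivity]
  refine ENNReal.ofReal_le_ofReal ?_
  have hsplit : ∀ k, ‖mFourierCoeff f k‖ ≤ ‖mFourierCoeff f₁ k‖ + ‖mFourierCoeff f₂ k‖ := by
    intro k
    conv_lhs => rw [hsum]
    rw [mFourierCoeff_add hi₁ hi₂]
    exact norm_add_le _ _
  -- If the sum exceeds `t`, one of the two parts exceeds `t / 2`; the coefficient of `f₁` is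
  -- replaced by its uniform bound `A`.
  have hsub : S.filter (fun k => t < n k * ‖mFourierCoeff f k‖) ⊆
      S.filter (fun k => t / 2 < n k * A) ∪
        S.filter (fun k => t / 2 < n k * ‖mFourierCoeff f₂ k‖) := by
    intro k hk
    simp only [Finset.mem_union, Finset.mem_filter] at hk ⊢
    by_contra hcon
    push Not at hcon
    have h1 := hcon.1 hk.1
    have h2 := hcon.2 hk.1
    have h3 := norm_mFourierCoeff_le f₁ k
    have h4 : (n k : ℝ) * ‖mFourierCoeff f k‖ ≤ n k * (A + ‖mFourierCoeff f₂ k‖) :=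
      mul_le_mul_of_nonneg_left ((hsplit k).trans (by linarith)) (Nat.cast_nonneg _)
    linarith [hk.2]
  have hlow : ∑ k ∈ S with t / 2 < n k * A, ((n k : ℝ) ^ 2)⁻¹ ≤ 4 / t * A := by
    rcases hA0.eq_or_lt with h0 | h0
    · rw [← h0, Finset.filter_false_of_mem]
      · simp
      · intro k _
        simpa using (half_pos ht).le
    · have := sum_inv_sq_filter_lt_le hn (s := t / 2 / A) (by positivity)
      simp_rw [div_lt_iff₀ h0] at this
      refine this.trans (le_of_eq ?_)
      field_simp
      ring
  -- Chebyshev: on this set `(n k)⁻²` is at most `4 / t ^ 2` times the squared coefficient. Bessel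
  -- then applies to the bounded part `f₂`.
  have hhigh : ∑ k ∈ S with t / 2 < n k * ‖mFourierCoeff f₂ k‖, ((n k : ℝ) ^ 2)⁻¹ ≤
      4 / t ^ 2 * B := by
    calc _ ≤ ∑ k ∈ S with t / 2 < n k * ‖mFourierCoeff f₂ k‖,
          4 / t ^ 2 * ‖mFourierCoeff f₂ k‖ ^ 2 := by
          refine Finset.sum_le_sum fun k hk => ?_
          obtain ⟨hk, hkt⟩ := Finset.mem_filter.1 hk
          have hnk : (0 : ℝ) < n k := by exact_mod_cast hn1 k hk
          have := pow_le_pow_left₀ (by positivity) hkt.le 2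
          rw [mul_pow, div_pow] at this
          rw [inv_le_iff_one_le_mul₀ (by positivity)]
          rw [div_le_iff₀ (by positivity)] at this
          rw [div_mul_eq_mul_div, div_mul_eq_mul_div, le_div_iff₀ (by positivity)]
          linarith
      _ ≤ ∑ k ∈ S, 4 / t ^ 2 * ‖mFourierCoeff f₂ k‖ ^ 2 :=
          Finset.sum_le_sum_of_subset_of_nonneg (Finset.filter_subset _ _)
            fun _ _ _ => by positivity
      _ ≤ _ := by
          rw [← Finset.mul_sum]
          exact mul_le_mul_of_nonneg_left (sum_sq_norm_mFourierCoeff_le hm₂ S) (by positivity)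
  classical
  refine (Finset.sum_le_sum_of_subset_of_nonneg hsub fun _ _ _ => by positivity).trans ?_
  refine le_trans ?_ (add_le_add hlow hhigh)
  rw [← Finset.sum_union_inter]
  exact le_add_of_nonneg_right (Finset.sum_nonneg fun _ _ => by positivity)

/-- By Fubini, each `x` sees `t^(p-2)` integrated over `(0, ‖f x‖)`, which converges at `0` because
`p > 1`. -/
theorem lintegral_lintegral_enorm_of_lt {α : Type*} [MeasurableSpace α] {μ : Measure α} [SFinite μ]
    {f : α → ℂ} (hf : StronglyMeasurable f) {p : ℝ} (hp : 1 < p) :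
    ∫⁻ t in Set.Ioi (0 : ℝ), ENNReal.ofReal (t ^ (p - 1 - 1)) * ∫⁻ x in {x | t < ‖f x‖}, ‖f x‖ₑ ∂μ =
      ENNReal.ofReal (1 / (p - 1)) * ∫⁻ x, ‖f x‖ₑ ^ p ∂μ := by
  have hfm := hf.measurable
  have hset : MeasurableSet {z : ℝ × α | z.1 < ‖f z.2‖} :=
    measurableSet_lt measurable_fst (hfm.norm.comp measurable_snd)
  have hind : Measurable fun z : ℝ × α => (Set.Iio ‖f z.2‖).indicator (1 : ℝ → ENNReal) z.1 :=
    (measurable_one.indicator hset : Measurable ({z : ℝ × α | z.1 < ‖f z.2‖}.indicator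
      (1 : ℝ × α → ENNReal)))
  have h1 : ∀ t : ℝ, ENNReal.ofReal (t ^ (p - 1 - 1)) * ∫⁻ x in {x | t < ‖f x‖}, ‖f x‖ₑ ∂μ =
      ∫⁻ x, ENNReal.ofReal (t ^ (p - 1 - 1)) * (Set.Iio ‖f x‖).indicator 1 t * ‖f x‖ₑ ∂μ := by
    intro t
    have hm : MeasurableSet {x | t < ‖f x‖} := measurableSet_lt measurable_const hfm.norm
    rw [← lintegral_indicator hm, ← lintegral_const_mul _ (hfm.enorm.indicator hm)]
    refine lintegral_congr fun x => ?_
    by_cases hx : t < ‖f x‖ <;> simp [hx]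
  simp_rw [h1]
  rw [lintegral_lintegral_swap (by fun_prop), ← lintegral_const_mul _ (by fun_prop)]
  refine lintegral_congr fun x => ?_
  have hmx : Measurable fun t : ℝ =>
      ENNReal.ofReal (t ^ (p - 1 - 1)) * (Set.Iio ‖f x‖).indicator (1 : ℝ → ENNReal) t :=
    Measurable.mul (by fun_prop) (measurable_one.indicator measurableSet_Iio)
  rw [lintegral_mul_const _ hmx,
    lintegral_rpow_mul_indicator_Iio (by linarith) (norm_nonneg _), ← ofReal_norm,
    ENNReal.ofReal_rpow_of_nonneg (norm_nonneg _) (by linarith),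
    ← ENNReal.ofReal_mul (div_nonneg (by positivity) (by linarith)),
    ← ENNReal.ofReal_mul (div_nonneg zero_le_one (by linarith))]
  congr 1
  have := Real.rpow_add_one' (norm_nonneg (f x)) (y := p - 1) (by linarith)
  rw [sub_add_cancel] at this
  rw [this]
  ring

/-- By Fubini, each `x` sees `t^(p-3)` integrated over `[‖f x‖, ∞)`, which converges at infinity
because `p < 2`. Points with `f x = 0` are treated apart, the integral there being multiplied by
`0`. -/
theorem lintegral_lintegral_enorm_sq_compl {α : Type*} [MeasurableSpace α] {μ : Measure α}
    [SFinite μ] {f : α → ℂ} (hf : StronglyMeasurable f) {p : ℝ} (hp0 : 0 < p) (hp : p < 2) :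
    ∫⁻ t in Set.Ioi (0 : ℝ), ENNReal.ofReal (t ^ (-(2 - p) - 1)) *
        ∫⁻ x in {x | t < ‖f x‖}ᶜ, ‖f x‖ₑ ^ 2 ∂μ =
      ENNReal.ofReal (1 / (2 - p)) * ∫⁻ x, ‖f x‖ₑ ^ p ∂μ := by
  have hfm := hf.measurable
  have hset : MeasurableSet {z : ℝ × α | ‖f z.2‖ ≤ z.1} :=
    measurableSet_le (hfm.norm.comp measurable_snd) measurable_fst
  have hind : Measurable fun z : ℝ × α => (Set.Ici ‖f z.2‖).indicator (1 : ℝ → ENNReal) z.1 :=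
    (measurable_one.indicator hset : Measurable ({z : ℝ × α | ‖f z.2‖ ≤ z.1}.indicator
      (1 : ℝ × α → ENNReal)))
  have h1 : ∀ t : ℝ, ENNReal.ofReal (t ^ (-(2 - p) - 1)) *
        ∫⁻ x in {x | t < ‖f x‖}ᶜ, ‖f x‖ₑ ^ 2 ∂μ =
      ∫⁻ x, ENNReal.ofReal (t ^ (-(2 - p) - 1)) * (Set.Ici ‖f x‖).indicator 1 t *
        ‖f x‖ₑ ^ 2 ∂μ := by
    intro t
    have hm : MeasurableSet {x | t < ‖f x‖}ᶜ := (measurableSet_lt measurable_const hfm.norm).compl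
    rw [← lintegral_indicator hm, ← lintegral_const_mul _ ((hfm.enorm.pow_const 2).indicator hm)]
    refine lintegral_congr fun x => ?_
    by_cases hx : t < ‖f x‖
    · simp [hx, not_le.2 hx]
    · simp [hx, not_lt.1 hx]
  simp_rw [h1]
  rw [lintegral_lintegral_swap (by fun_prop), ← lintegral_const_mul _ (by fun_prop)]
  refine lintegral_congr fun x => ?_
  have hmx : Measurable fun t : ℝ =>
      ENNReal.ofReal (t ^ (-(2 - p) - 1)) * (Set.Ici ‖f x‖).indicator (1 : ℝ → ENNReal) t :=
    Measurable.mul (by fun_prop) (measurable_one.indicator measurableSet_Ici)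
  rw [lintegral_mul_const _ hmx]
  rcases (norm_nonneg (f x)).eq_or_lt with h0 | h0
  · have hx : f x = 0 := norm_eq_zero.1 h0.symm
    simp [hx, ENNReal.zero_rpow_of_pos hp0]
  rw [lintegral_rpow_mul_indicator_Ici (by linarith) h0, ← ofReal_norm,
    ENNReal.ofReal_rpow_of_nonneg (norm_nonneg _) hp0.le,
    ← ENNReal.ofReal_pow (norm_nonneg _),
    ← ENNReal.ofReal_mul (div_nonneg (by positivity) (by linarith)),
    ← ENNReal.ofReal_mul (div_nonneg zero_le_one (by linarith))]
  congr 1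
  have := Real.rpow_add h0 (-(2 - p)) 2
  rw [show -(2 - p) + 2 = p by ring, Real.rpow_two] at this
  rw [this]
  ring

/-- **Paley's inequality**, uniformly over finite sets of frequencies and their enumerations. -/
theorem sum_rank_rpow_mul_norm_mFourierCoeff_le {d : ℕ} {f : UnitAddTorus (Fin d) → ℂ}
    (hfm : StronglyMeasurable f) (hf : Integrable f (torusMeasure d)) {S : Finset (Fin d → ℤ)}
    {n : (Fin d → ℤ) → ℕ} (hn : Set.InjOn n S) (hn1 : ∀ k ∈ S, 1 ≤ n k) {p : ℝ} (hp1 : 1 < p)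
    (hp2 : p < 2) :
    ∑ k ∈ S, ENNReal.ofReal ((n k : ℝ) ^ (p - 2) * ‖mFourierCoeff f k‖ ^ p) ≤
      ENNReal.ofReal (4 * p / (p - 1) + 4 * p / (2 - p)) *
        ∫⁻ x, ‖f x‖ₑ ^ p ∂(torusMeasure d) := by
  have hp0 : 0 < p := by linarith
  have hp1' : 0 < p - 1 := by linarith
  have hp2' : 0 < 2 - p := by linarith
  set y : (Fin d → ℤ) → ℝ := fun k => n k * ‖mFourierCoeff f k‖ with hy
  have hy0 : ∀ k, 0 ≤ y k := fun k => by positivity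
  have hm : ∀ k, Measurable fun t : ℝ =>
      ENNReal.ofReal (t ^ (p - 1)) * (Set.Iio (y k)).indicator (1 : ℝ → ENNReal) t :=
    fun k => Measurable.mul (by fun_prop) (measurable_one.indicator measurableSet_Iio)
  -- Write `n^(p-2) |f̂|^p` as `n⁻² (n |f̂|)^p` and apply the layer-cake formula to `y k = n |f̂|`.
  have hlayer : ∀ k ∈ S, ENNReal.ofReal ((n k : ℝ) ^ (p - 2) * ‖mFourierCoeff f k‖ ^ p) =
      ∫⁻ t in Set.Ioi (0 : ℝ), ENNReal.ofReal (p * ((n k : ℝ) ^ 2)⁻¹) *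
        (ENNReal.ofReal (t ^ (p - 1)) * (Set.Iio (y k)).indicator 1 t) := by
    intro k hk
    have hnk : (0 : ℝ) < n k := by exact_mod_cast hn1 k hk
    rw [lintegral_const_mul _ (hm k), lintegral_rpow_mul_indicator_Iio hp0 (hy0 k),
      ← ENNReal.ofReal_mul (by positivity), hy]
    congr 1
    simp only
    rw [Real.mul_rpow hnk.le (norm_nonneg _), Real.rpow_sub hnk, Real.rpow_two]
    field_simp
  have hmA : Measurable fun t : ℝ => ∫⁻ x in {x | t < ‖f x‖}, ‖f x‖ₑ ∂(torusMeasure d) := by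
    refine Antitone.measurable fun s t hst => lintegral_mono_set fun x hx => ?_
    exact lt_of_le_of_lt hst hx
  rw [Finset.sum_congr rfl hlayer, ← lintegral_finsetSum _ fun k _ => (hm k).const_mul _]
  calc _ ≤ ∫⁻ t in Set.Ioi (0 : ℝ),
        (ENNReal.ofReal (4 * p) * (ENNReal.ofReal (t ^ (p - 1 - 1)) *
          ∫⁻ x in {x | t < ‖f x‖}, ‖f x‖ₑ ∂(torusMeasure d)) +
        ENNReal.ofReal (4 * p) * (ENNReal.ofReal (t ^ (-(2 - p) - 1)) *
          ∫⁻ x in {x | t < ‖f x‖}ᶜ, ‖f x‖ₑ ^ 2 ∂(torusMeasure d))) := by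
        refine setLIntegral_mono' measurableSet_Ioi fun t ht => ?_
        have ht : 0 < t := ht
        have h1 : ∑ k ∈ S, ENNReal.ofReal (p * ((n k : ℝ) ^ 2)⁻¹) *
            (ENNReal.ofReal (t ^ (p - 1)) * (Set.Iio (y k)).indicator 1 t) =
            ENNReal.ofReal (p * t ^ (p - 1)) *
              ∑ k ∈ S with t < n k * ‖mFourierCoeff f k‖, ENNReal.ofReal ((n k : ℝ) ^ 2)⁻¹ := by
          rw [Finset.sum_filter, Finset.mul_sum]
          refine Finset.sum_congr rfl fun k _ => ?_
          rw [ENNReal.ofReal_mul hp0.le, ENNReal.ofReal_mul hp0.le]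
          by_cases h : t < n k * ‖mFourierCoeff f k‖
          · simp only [hy, Set.mem_Iio, h, Set.indicator_of_mem, Pi.one_apply, if_true, mul_one]
            ring
          · simp [hy, h]
        rw [h1]
        refine (mul_le_mul_right (sum_inv_sq_rank_le hfm hf hn hn1 ht) _).trans (le_of_eq ?_)
        rw [mul_add, ← mul_assoc, ← mul_assoc, ← mul_assoc, ← mul_assoc,
          ← ENNReal.ofReal_mul (by positivity), ← ENNReal.ofReal_mul (by positivity),
          ← ENNReal.ofReal_mul (by positivity), ← ENNReal.ofReal_mul (by positivity)]
        congr 3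
        · rw [Real.rpow_sub_one ht.ne' (p - 1)]
          ring
        · rw [show -(2 - p) - 1 = p - 1 - 2 by ring, Real.rpow_sub ht (p - 1) 2, Real.rpow_two]
          ring
    _ = _ := by
        rw [lintegral_add_left (by fun_prop), lintegral_const_mul' _ _ ENNReal.ofReal_ne_top,
          lintegral_const_mul' _ _ ENNReal.ofReal_ne_top, lintegral_lintegral_enorm_of_lt hfm hp1,
          lintegral_lintegral_enorm_sq_compl hfm hp0 hp2, ← mul_assoc, ← mul_assoc,
          ← ENNReal.ofReal_mul (by positivity), ← ENNReal.ofReal_mul (by positivity), ← add_mul,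
          ← ENNReal.ofReal_add (by positivity) (by positivity), mul_one_div, mul_one_div]

/-! ### Boundedness into the Lorentz sequence space -/

/-- Ranks exist only on finite sets, so Paley's inequality is applied on each finite `S`, with a
constant independent of `S`. Fatou's lemma along an exhaustion of the frequency lattice then gives
the full count. -/
theorem lintegral_count_mFourierCoeff_le {d : ℕ} {f : UnitAddTorus (Fin d) → ℂ}
    (hfm : StronglyMeasurable f) (hf : Integrable f (torusMeasure d)) {p : ℝ} (hp1 : 1 < p)
    (hp2 : p < 2) :
    ∫⁻ t in Set.Ioi (0 : ℝ), ENNReal.ofReal (t ^ (p - 1)) *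
        (Measure.count : Measure (Fin d → ℤ)) {k | t < ‖mFourierCoeff f k‖} ^ (p - 1) ≤
      ENNReal.ofReal (4 / (p - 1) + 4 / (2 - p)) * ∫⁻ x, ‖f x‖ₑ ^ p ∂(torusMeasure d) := by
  classical
  have hp0 : 0 < p := by linarith
  have hp1' : 0 < p - 1 := by linarith
  have hp2' : 0 < 2 - p := by linarith
  have hfin : ∀ S : Finset (Fin d → ℤ), ∫⁻ t in Set.Ioi (0 : ℝ), ENNReal.ofReal (t ^ (p - 1)) *
        ((S.filter fun k => t < ‖mFourierCoeff f k‖).card : ENNReal) ^ (p - 1) ≤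
      ENNReal.ofReal (4 / (p - 1) + 4 / (2 - p)) * ∫⁻ x, ‖f x‖ₑ ^ p ∂(torusMeasure d) := by
    intro S
    obtain ⟨n, hinj, hn⟩ := exists_injOn_rank S fun k => ‖mFourierCoeff f k‖
    refine (lintegral_card_filter_rpow_le (fun _ => norm_nonneg _) hn hp1 hp2).trans ?_
    refine (mul_le_mul_right (sum_rank_rpow_mul_norm_mFourierCoeff_le hfm hf hinj
      (fun k hk => (hn k hk).1) hp1 hp2) _).trans (le_of_eq ?_)
    rw [← mul_assoc, ← ENNReal.ofReal_mul (by positivity)]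
    congr 2
    field_simp
  obtain ⟨S, hSm, hS⟩ := Filter.exists_seq_monotone_tendsto_atTop_atTop (Finset (Fin d → ℤ))
  have hlim : ∀ t : ℝ, Filter.Tendsto (fun i => ENNReal.ofReal (t ^ (p - 1)) *
        (((S i).filter fun k => t < ‖mFourierCoeff f k‖).card : ENNReal) ^ (p - 1)) Filter.atTop
      (nhds (ENNReal.ofReal (t ^ (p - 1)) *
        (Measure.count : Measure (Fin d → ℤ)) {k | t < ‖mFourierCoeff f k‖} ^ (p - 1))) := by
    intro t
    refine ENNReal.Tendsto.const_mul ?_ (Or.inr ENNReal.ofReal_ne_top)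
    refine ((ENNReal.continuous_rpow_const (y := p - 1)).tendsto _).comp ?_
    have hU : {k | t < ‖mFourierCoeff f k‖} =
        ⋃ i, (((S i).filter fun k => t < ‖mFourierCoeff f k‖ : Finset _) : Set (Fin d → ℤ)) := by
      ext k
      simp only [Set.mem_ofPred_eq, Set.mem_iUnion, Finset.coe_filter]
      constructor
      · intro hk
        obtain ⟨i, hi⟩ := (hS.eventually (Filter.eventually_ge_atTop {k})).exists
        exact ⟨i, Finset.singleton_subset_iff.1 hi, hk⟩
      · rintro ⟨i, -, hk⟩
        exact hk
    rw [hU]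
    have := tendsto_measure_iUnion_atTop (μ := (Measure.count : Measure (Fin d → ℤ)))
      (s := fun i => (((S i).filter fun k => t < ‖mFourierCoeff f k‖ : Finset _) :
        Set (Fin d → ℤ)))
      (fun i j hij => Finset.coe_subset.2 (Finset.filter_subset_filter _ (hSm hij)))
    simpa only [Function.comp_def, Measure.count_apply_finset] using this
  have hmono : ∀ i, Measurable fun t : ℝ => ENNReal.ofReal (t ^ (p - 1)) *
        (((S i).filter fun k => t < ‖mFourierCoeff f k‖).card : ENNReal) ^ (p - 1) := by
    intro i
    have : Antitone fun t : ℝ =>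
        (((S i).filter fun k => t < ‖mFourierCoeff f k‖).card : ENNReal) ^ (p - 1) := by
      intro s t hst
      refine ENNReal.rpow_le_rpow (Nat.cast_le.2 (Finset.card_le_card ?_)) hp1'.le
      exact Finset.monotone_filter_right _ fun k _ hk => lt_of_le_of_lt hst hk
    have := this.measurable
    fun_prop
  calc _ = ∫⁻ t in Set.Ioi (0 : ℝ), Filter.liminf (fun i => ENNReal.ofReal (t ^ (p - 1)) *
        (((S i).filter fun k => t < ‖mFourierCoeff f k‖).card : ENNReal) ^ (p - 1))
        Filter.atTop := lintegral_congr fun t => (hlim t).liminf_eq.symm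
    _ ≤ _ := lintegral_liminf_le hmono
    _ ≤ _ := Filter.liminf_le_of_le (by isBoundedDefault) fun b hb => by
        obtain ⟨i, hi⟩ := hb.exists
        exact hi.trans (hfin _)

theorem integrable_coeFn_Lp {α : Type*} [MeasurableSpace α] {μ : Measure α} [IsFiniteMeasure μ]
    {p : ℝ} (hp : 1 ≤ p) (f : Lp ℂ (ENNReal.ofReal p) μ) : Integrable f μ :=
  (Lp.memLp f).integrable (ENNReal.one_le_ofReal.2 hp)

theorem lintegral_enorm_rpow_eq_eLpNorm {α : Type*} [MeasurableSpace α] {μ : Measure α}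
    {p : ℝ} (hp : 0 < p) (f : α → ℂ) :
    (∫⁻ x, ‖f x‖ₑ ^ p ∂μ) ^ (1 / p) = eLpNorm f (ENNReal.ofReal p) μ := by
  rw [eLpNorm_eq_lintegral_rpow_enorm_toReal (by simpa using hp) ENNReal.ofReal_ne_top,
    ENNReal.toReal_ofReal hp.le]

theorem eLorentzNorm_mFourierCoeff_le {d : ℕ} {p q : ℝ} (hp1 : 1 < p) (hp2 : p < 2)
    (hpq : p.HolderConjugate q) (f : Lp ℂ (ENNReal.ofReal p) (torusMeasure d)) :
    eLorentzNorm (mFourierCoeff (d := Fin d) f) q p Measure.count ≤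
      ENNReal.ofReal (q ^ (1 / p) * (4 / (p - 1) + 4 / (2 - p)) ^ (1 / p)) *
        eLpNorm f (ENNReal.ofReal p) (torusMeasure d) := by
  have hp0 : 0 < p := hpq.pos
  have hp1' : 0 < p - 1 := by linarith
  have hp2' : 0 < 2 - p := by linarith
  have hq : p / q = p - 1 := by
    rw [div_eq_iff hpq.symm.ne_zero, hpq.sub_one_mul_conj]
  have hq0 := hpq.symm.pos
  rw [eLorentzNorm, hq, ← lintegral_enorm_rpow_eq_eLpNorm hp0, ENNReal.ofReal_mul (by positivity),
    mul_assoc, ← ENNReal.ofReal_rpow_of_nonneg (p := 1 / p)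
      (by positivity : 0 ≤ 4 / (p - 1) + 4 / (2 - p)) (by positivity),
    ← ENNReal.mul_rpow_of_nonneg _ _ (by positivity : 0 ≤ 1 / p)]
  refine mul_le_mul_right (ENNReal.rpow_le_rpow ?_ (by positivity)) _
  exact lintegral_count_mFourierCoeff_le (Lp.stronglyMeasurable f)
    (integrable_coeFn_Lp hp1.le f) hp1 hp2

/-- The discrete Fourier transform as a linear map from `L^p(𝕋^d)` to `ℓ^{p',p}(ℤ^d)`. -/
noncomputable def fourierLorentz (d : ℕ) {p q : ℝ} (hp1 : 1 < p) (hp2 : p < 2)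
    (hpq : p.HolderConjugate q) :
    Lp ℂ (ENNReal.ofReal p) (torusMeasure d) →ₗ[ℂ]
      lorentzSeq (Fin d → ℤ) q p hpq.symm.pos hpq.pos where
  toFun f := ⟨mFourierCoeff (d := Fin d) f, (eLorentzNorm_mFourierCoeff_le hp1 hp2 hpq f).trans_lt
    (ENNReal.mul_lt_top ENNReal.ofReal_lt_top (Lp.memLp f).2)⟩
  map_add' f g := by
    ext k
    change mFourierCoeff (d := Fin d) (f + g : Lp ℂ (ENNReal.ofReal p) (torusMeasure d)) k =
      mFourierCoeff (d := Fin d) f k + mFourierCoeff (d := Fin d) g k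
    rw [mFourierCoeff_congr_ae (Lp.coeFn_add f g), mFourierCoeff_add
      (integrable_coeFn_Lp hp1.le f) (integrable_coeFn_Lp hp1.le g)]
  map_smul' c f := by
    ext k
    change mFourierCoeff (d := Fin d) (c • f : Lp ℂ (ENNReal.ofReal p) (torusMeasure d)) k =
      c • mFourierCoeff (d := Fin d) f k
    rw [mFourierCoeff_congr_ae (Lp.coeFn_smul c f), mFourierCoeff_const_smul]

theorem isBoundedOperator_fourierLorentz (d : ℕ) {p q : ℝ} (hp1 : 1 < p) (hp2 : p < 2)
    (hpq : p.HolderConjugate q) : IsBoundedOperator (fourierLorentz d hp1 hp2 hpq) := by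
  have hp1' : 0 < p - 1 := by linarith
  have hp2' : 0 < 2 - p := by linarith
  have hq0 := hpq.symm.pos
  refine ⟨q ^ (1 / p) * (4 / (p - 1) + 4 / (2 - p)) ^ (1 / p), fun f => ?_⟩
  have h := eLorentzNorm_mFourierCoeff_le hp1 hp2 hpq f
  have h2 := ENNReal.toReal_mono
    (ENNReal.mul_lt_top ENNReal.ofReal_lt_top (Lp.memLp f).2).ne h
  rwa [ENNReal.toReal_mul, ENNReal.toReal_ofReal (by positivity)] at h2

/-! ### Lower bounds: lacunary blocks and small perturbations -/

theorem sum_range_succ_le_two_mul {y : ℕ → ℝ} (h0 : 0 ≤ y 0) (hy : ∀ n, 2 * y n ≤ y (n + 1))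
    (n : ℕ) : ∑ i ∈ Finset.range (n + 1), y i ≤ 2 * y n := by
  induction n with
  | zero => simpa using by linarith
  | succ n ih =>
    rw [Finset.sum_range_succ]
    linarith [hy n]

/-- A sequence that is large on blocks of lacunary cardinality has large Lorentz
integral. -/
theorem sum_block_le_lintegral {ι : Type*} [MeasurableSpace ι] [MeasurableSingletonClass ι]
    {p : ℝ} (hp : 1 < p) {N : ℕ → ℕ} (hN : ∀ n, 2 * (N n : ℝ) ^ (p - 1) ≤ (N (n + 1) : ℝ) ^ (p - 1))
    {T : Finset ℕ} {B : ℕ → Finset ι} (hB : ∀ n, (B n).card = N n) {u : ι → ℂ} {v : ℕ → ℝ}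
    (hv0 : ∀ n, 0 ≤ v n) (hv : ∀ n ∈ T, ∀ k ∈ B n, v n ≤ ‖u k‖) :
    ENNReal.ofReal (∑ n ∈ T, (N n : ℝ) ^ (p - 1) * v n ^ p) ≤
      ENNReal.ofReal (2 * p) * ∫⁻ t in Set.Ioi (0 : ℝ), ENNReal.ofReal (t ^ (p - 1)) *
        (Measure.count : Measure ι) {k | t < ‖u k‖} ^ (p - 1) := by
  have hp0 : 0 < p := by linarith
  have hm : ∀ n, Measurable fun t : ℝ =>
      ENNReal.ofReal (t ^ (p - 1)) * (Set.Iio (v n)).indicator (1 : ℝ → ENNReal) t :=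
    fun n => Measurable.mul (by fun_prop) (measurable_one.indicator measurableSet_Iio)
  have key : ∀ t : ℝ, ∑ n ∈ T with t < v n, ENNReal.ofReal ((N n : ℝ) ^ (p - 1)) ≤
      2 * (Measure.count : Measure ι) {k | t < ‖u k‖} ^ (p - 1) := by
    intro t
    rcases (T.filter fun n => t < v n).eq_empty_or_nonempty with h | h
    · simp [h]
    -- The largest active index `m` suffices: by lacunarity the sum over all active blocks is at
    -- most twice the term of block `m`, and the whole of that block lies above height `t`.
    obtain ⟨m, hm, hmax⟩ := Finset.exists_max_image _ id h
    obtain ⟨hmT, htm⟩ := Finset.mem_filter.1 hm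
    have h1 : (N m : ENNReal) ≤ (Measure.count : Measure ι) {k | t < ‖u k‖} := by
      rw [← hB m, ← Measure.count_apply_finset]
      exact measure_mono fun k hk => htm.trans_le (hv m hmT k hk)
    rw [← ENNReal.ofReal_sum_of_nonneg fun _ _ => by positivity]
    calc _ ≤ ENNReal.ofReal (2 * (N m : ℝ) ^ (p - 1)) := by
          refine ENNReal.ofReal_le_ofReal (le_trans ?_ (sum_range_succ_le_two_mul
            (y := fun n => (N n : ℝ) ^ (p - 1)) (by positivity) hN m))
          refine Finset.sum_le_sum_of_subset_of_nonneg (fun n hn => ?_) fun _ _ _ => by positivity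
          exact Finset.mem_range_succ_iff.2 (hmax n hn)
      _ = 2 * (N m : ENNReal) ^ (p - 1) := by
          rw [ENNReal.ofReal_mul zero_le_two, ← ENNReal.ofReal_rpow_of_nonneg (Nat.cast_nonneg _)
            (by linarith), ENNReal.ofReal_natCast, ENNReal.ofReal_ofNat]
      _ ≤ _ := by
          gcongr
  have hlayer : ENNReal.ofReal (∑ n ∈ T, (N n : ℝ) ^ (p - 1) * v n ^ p) =
      ∫⁻ t in Set.Ioi (0 : ℝ), ∑ n ∈ T, ENNReal.ofReal (p * (N n : ℝ) ^ (p - 1)) *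
        (ENNReal.ofReal (t ^ (p - 1)) * (Set.Iio (v n)).indicator 1 t) := by
    rw [lintegral_finsetSum _ fun n _ => (hm n).const_mul _, ENNReal.ofReal_sum_of_nonneg
      fun n _ => mul_nonneg (by positivity) (Real.rpow_nonneg (hv0 n) _)]
    refine Finset.sum_congr rfl fun n _ => ?_
    rw [lintegral_const_mul _ (hm n), lintegral_rpow_mul_indicator_Iio hp0 (hv0 n),
      ← ENNReal.ofReal_mul (by positivity)]
    congr 1
    field_simp
  rw [hlayer, ← lintegral_const_mul' _ _ ENNReal.ofReal_ne_top]
  refine lintegral_mono fun t => ?_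
  have h1 : ∑ n ∈ T, ENNReal.ofReal (p * (N n : ℝ) ^ (p - 1)) *
      (ENNReal.ofReal (t ^ (p - 1)) * (Set.Iio (v n)).indicator 1 t) =
      ENNReal.ofReal p * ENNReal.ofReal (t ^ (p - 1)) *
        ∑ n ∈ T with t < v n, ENNReal.ofReal ((N n : ℝ) ^ (p - 1)) := by
    rw [Finset.sum_filter, Finset.mul_sum]
    refine Finset.sum_congr rfl fun n _ => ?_
    rw [ENNReal.ofReal_mul hp0.le]
    by_cases h : t < v n
    · simp only [Set.mem_Iio, h, Set.indicator_of_mem, Pi.one_apply, if_true, mul_one]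
      ring
    · simp [h]
  rw [h1]
  refine (mul_le_mul_right (key t) _).trans (le_of_eq ?_)
  rw [mul_comm 2 p, ENNReal.ofReal_mul hp0.le, ENNReal.ofReal_ofNat]
  ring

theorem rpow_add_le_two_mul {p : ℝ} (hp1 : 1 ≤ p) (hp2 : p ≤ 2) {a b : ℝ} (ha : 0 ≤ a)
    (hb : 0 ≤ b) : (a + b) ^ p ≤ 2 * (a ^ p + b ^ p) := by
  lift a to NNReal using ha
  lift b to NNReal using hb
  have h := NNReal.rpow_add_le_mul_rpow_add_rpow a b hp1
  have h2 : (2 : NNReal) ^ (p - 1) ≤ 2 := by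
    simpa using NNReal.rpow_le_rpow_of_exponent_le (x := 2) (by norm_num) (by linarith : p - 1 ≤ 1)
  exact_mod_cast h.trans (mul_le_mul_left h2 _)

/-- Small perturbations with rank one coefficients `ε^(n+1) ε^(m+1)` do not destroy the `ℓ^p`
norm. -/
theorem sum_rpow_le_four_mul_sum_perturb {p ε : ℝ} (hp1 : 1 ≤ p) (hp2 : p ≤ 2) (hε0 : 0 ≤ ε)
    (hε : ε ≤ 1 / 4) (T : Finset ℕ) {a : ℕ → ℝ} (ha : ∀ n, 0 ≤ a n) :
    ∑ n ∈ T, a n ^ p ≤ 4 * ∑ n ∈ T,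
      (max 0 (a n - 2 * ∑ m ∈ T.erase n, ε ^ (n + 1) * ε ^ (m + 1) * a m)) ^ p := by
  have hp0 : 0 < p := by linarith
  set P := ∑ n ∈ T, a n ^ p with hP
  set b : ℕ → ℝ := fun n => 2 * ∑ m ∈ T.erase n, ε ^ (n + 1) * ε ^ (m + 1) * a m with hb
  have hP0 : 0 ≤ P := Finset.sum_nonneg fun n _ => Real.rpow_nonneg (ha n) _
  set A := P ^ (1 / p) with hA
  have hA0 : 0 ≤ A := Real.rpow_nonneg hP0 _
  have hAP : A ^ p = P := by rw [hA, ← Real.rpow_mul hP0, one_div_mul_cancel hp0.ne', Real.rpow_one]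
  have haA : ∀ n ∈ T, a n ≤ A := by
    intro n hn
    rw [← Real.rpow_le_rpow_iff (ha n) hA0 hp0, hAP]
    exact Finset.single_le_sum (f := fun n => a n ^ p) (fun n _ => Real.rpow_nonneg (ha n) _) hn
  have hgeo : ∀ T' : Finset ℕ, ∑ m ∈ T', ε ^ (m + 1) ≤ 1 / 3 := by
    intro T'
    have hε1 : ε < 1 := by linarith
    have h1 := (summable_geometric_of_lt_one hε0 hε1).sum_le_tsum T' fun _ _ => by positivity
    rw [tsum_geometric_of_lt_one hε0 hε1] at h1
    simp_rw [pow_succ]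
    rw [← Finset.sum_mul]
    calc _ ≤ (1 - ε)⁻¹ * ε := mul_le_mul_of_nonneg_right h1 hε0
      _ ≤ 1 / 3 := by
        rw [inv_mul_le_iff₀ (by linarith)]
        linarith
  have hb0 : ∀ n, 0 ≤ b n := fun n => mul_nonneg zero_le_two
    (Finset.sum_nonneg fun m _ => mul_nonneg (by positivity) (ha m))
  -- Each `a m` is at most the `ℓ^p` norm `A`, and the geometric series with ratio at most `1 / 4`
  -- sums to at most `1 / 3`.
  have hbA : ∀ n, b n ≤ 2 / 3 * ε ^ (n + 1) * A := by
    intro n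
    calc b n ≤ 2 * ∑ m ∈ T.erase n, ε ^ (n + 1) * ε ^ (m + 1) * A := by
          simp only [hb]
          gcongr with m hm
          exact haA m (Finset.mem_of_mem_erase hm)
      _ = 2 * (ε ^ (n + 1) * A) * ∑ m ∈ T.erase n, ε ^ (m + 1) := by
          rw [Finset.mul_sum, Finset.mul_sum]
          exact Finset.sum_congr rfl fun m _ => by ring
      _ ≤ 2 * (ε ^ (n + 1) * A) * (1 / 3) := by
          gcongr
          exact hgeo _
      _ = _ := by ring
  -- As `2 / 3 * ε ^ (n + 1) ≤ 1` and `p ≥ 1`, its `p`-th power may be dropped. The total is `2 / 9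
  -- * P`; after the factor 2 in `hpt`, at most `P / 2` is absorbed on the left, which leaves the
  -- constant 4.
  have hbp : ∑ n ∈ T, b n ^ p ≤ P / 4 := by
    calc _ ≤ ∑ n ∈ T, (2 / 3 * ε ^ (n + 1)) * P := by
          refine Finset.sum_le_sum fun n _ => ?_
          refine (Real.rpow_le_rpow (hb0 n) (hbA n) hp0.le).trans ?_
          rw [Real.mul_rpow (by positivity) hA0, hAP]
          refine mul_le_mul_of_nonneg_right ?_ hP0
          refine Real.rpow_le_self_of_le_one (by positivity) ?_ hp1
          have : ε ^ (n + 1) ≤ 1 := pow_le_one₀ hε0 (by linarith)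
          linarith
      _ = 2 / 3 * P * ∑ n ∈ T, ε ^ (n + 1) := by
          rw [Finset.mul_sum]
          exact Finset.sum_congr rfl fun m _ => by ring
      _ ≤ 2 / 3 * P * (1 / 3) := by
          gcongr
          exact hgeo _
      _ ≤ P / 4 := by linarith
  have hpt : ∀ n, a n ^ p ≤ 2 * (max 0 (a n - b n) ^ p + b n ^ p) := by
    intro n
    refine le_trans ?_ (rpow_add_le_two_mul hp1 hp2 (le_max_left _ _) (hb0 n))
    refine Real.rpow_le_rpow (ha n) ?_ hp0.le
    linarith [le_max_right 0 (a n - b n)]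
  have := Finset.sum_le_sum fun n (_ : n ∈ T) => hpt n
  rw [← Finset.mul_sum, Finset.sum_add_distrib] at this
  linarith

/-! ### Dyadic arcs, slabs and their exponential integrals -/

/-- The arc of the circle that is the image of `(h, 2h]`. -/
def dyadicArc (h : ℝ) : Set UnitAddCircle :=
  {y | (AddCircle.equivIoc 1 0 y : ℝ) ∈ Set.Ioc h (2 * h)}

/-- The set of points of the torus whose `i`-th coordinate lies in `dyadicArc h`. -/
def dyadicSlab {d : ℕ} (i : Fin d) (h : ℝ) : Set (UnitAddTorus (Fin d)) :=
  {x | x i ∈ dyadicArc h}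

theorem measurableSet_dyadicArc (h : ℝ) : MeasurableSet (dyadicArc h) :=
  (measurable_subtype_coe.comp (AddCircle.measurableEquivIoc 1 0).measurable) measurableSet_Ioc

theorem measurableSet_dyadicSlab {d : ℕ} (i : Fin d) (h : ℝ) : MeasurableSet (dyadicSlab i h) :=
  measurable_pi_apply i (measurableSet_dyadicArc h)

theorem dyadicArc_disjoint {h₁ h₂ : ℝ} (h : 2 * h₁ ≤ h₂) :
    Disjoint (dyadicArc h₁) (dyadicArc h₂) := by
  rw [Set.disjoint_left]
  intro y h1 h2
  have h3 := h1.2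
  have h4 := h2.1
  linarith

theorem volume_unitAddCircle_eq_haarAddCircle :
    (volume : Measure (AddCircle (1 : ℝ))) = AddCircle.haarAddCircle := by
  rw [AddCircle.volume_eq_smul_haarAddCircle, ENNReal.ofReal_one, one_smul]

theorem measurePreserving_coe_haarAddCircle :
    MeasurePreserving ((↑) : ℝ → AddCircle (1 : ℝ)) (volume.restrict (Set.Ioc 0 1))
      AddCircle.haarAddCircle := by
  have := AddCircle.measurePreserving_mk 1 0
  rwa [zero_add, volume_unitAddCircle_eq_haarAddCircle] at this

theorem coe_preimage_dyadicArc_inter {h : ℝ} (h0 : 0 < h) (h1 : 2 * h ≤ 1) :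
    ((↑) : ℝ → AddCircle (1 : ℝ)) ⁻¹' dyadicArc h ∩ Set.Ioc 0 1 = Set.Ioc h (2 * h) := by
  ext t
  constructor
  · rintro ⟨ht, ht1⟩
    rw [Set.mem_preimage, dyadicArc, Set.mem_ofPred_eq,
      AddCircle.equivIoc_coe_of_mem (a := 0) (by simpa using ht1)] at ht
    exact ht
  · intro ht
    have ht1 : t ∈ Set.Ioc (0 : ℝ) 1 := ⟨h0.trans ht.1, ht.2.trans h1⟩
    refine ⟨?_, ht1⟩
    rw [Set.mem_preimage, dyadicArc, Set.mem_ofPred_eq,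
      AddCircle.equivIoc_coe_of_mem (a := 0) (by simpa using ht1)]
    exact ht

theorem measurePreserving_eval_torusMeasure {d : ℕ} (i : Fin d) :
    MeasurePreserving (Function.eval i) (torusMeasure d) AddCircle.haarAddCircle :=
  measurePreserving_eval _ i

theorem torusMeasure_dyadicSlab {d : ℕ} (i : Fin d) {h : ℝ} (h0 : 0 < h) (h1 : 2 * h ≤ 1) :
    torusMeasure d (dyadicSlab i h) = ENNReal.ofReal h := by
  have hm := measurableSet_dyadicArc h
  have e1 := (measurePreserving_eval_torusMeasure i).measure_preimage hm.nullMeasurableSet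
  have e2 := measurePreserving_coe_haarAddCircle.measure_preimage hm.nullMeasurableSet
  rw [Measure.restrict_apply (AddCircle.measurable_mk' hm), coe_preimage_dyadicArc_inter h0 h1,
    Real.volume_Ioc, two_mul, add_sub_cancel_right] at e2
  rw [e2, ← e1]
  rfl

theorem setIntegral_dyadicSlab {d : ℕ} (i : Fin d) {h : ℝ} (h0 : 0 < h) (h1 : 2 * h ≤ 1)
    {g : UnitAddCircle → ℂ} (hg : Continuous g) :
    ∫ x in dyadicSlab i h, g (x i) ∂(torusMeasure d) = ∫ t in h..(2 * h), g t := by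
  have hm := measurableSet_dyadicArc h
  have e1 : ∫ y in dyadicArc h, g y ∂AddCircle.haarAddCircle =
      ∫ x in dyadicSlab i h, g (x i) ∂(torusMeasure d) := by
    rw [← (measurePreserving_eval_torusMeasure i).map_eq]
    exact setIntegral_map hm hg.aestronglyMeasurable (measurable_pi_apply i).aemeasurable
  have e2 : ∫ y in dyadicArc h, g y ∂AddCircle.haarAddCircle = ∫ t in h..(2 * h), g t := by
    rw [← measurePreserving_coe_haarAddCircle.map_eq, setIntegral_map hm hg.aestronglyMeasurable
      AddCircle.measurable_mk'.aemeasurable,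
      Measure.restrict_restrict (AddCircle.measurable_mk' hm), coe_preimage_dyadicArc_inter h0 h1,
      intervalIntegral.integral_of_le (by linarith)]
  rw [← e1, e2]

theorem mFourier_single_apply {d : ℕ} (i : Fin d) (j : ℤ) (x : UnitAddTorus (Fin d)) :
    mFourier (Pi.single i j) x = fourier j (x i) := by
  rw [mFourier, ContinuousMap.coe_mk, Finset.prod_eq_single i]
  · rw [Pi.single_eq_same]
  · intro b _ hb
    rw [Pi.single_eq_of_ne hb, fourier_zero]
  · simp

/-- The difference of exponentials at `2 * h` and `h` is a unimodular factor times `e^{iθ} - 1` with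
`θ = -2πjh`, whose modulus is `2 |sin (θ / 2)|`. -/
theorem norm_intervalIntegral_fourier {h : ℝ} {j : ℤ} (hj : 0 < j) :
    ‖∫ t in h..(2 * h), (fourier (-j) (t : AddCircle (1 : ℝ)) : ℂ)‖ =
      |Real.sin (Real.pi * j * h)| / (Real.pi * j) := by
  have hjr : (0 : ℝ) < j := by exact_mod_cast hj
  have hπ := Real.pi_pos
  set c : ℂ := Complex.I * ((-(2 * Real.pi * j) : ℝ) : ℂ) with hc
  have hcn : ‖c‖ = 2 * Real.pi * j := by
    rw [hc, norm_mul, Complex.norm_I, one_mul, Complex.norm_real, Real.norm_eq_abs, abs_neg,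
      abs_of_pos (by positivity)]
  have hc0 : c ≠ 0 := by
    rw [← norm_pos_iff, hcn]
    positivity
  have e1 : ∀ t : ℝ, (fourier (-j) (t : AddCircle (1 : ℝ)) : ℂ) = Complex.exp (c * t) := by
    intro t
    rw [fourier_coe_apply, hc]
    congr 1
    push_cast
    ring
  simp_rw [e1]
  rw [integral_exp_mul_complex hc0, norm_div, hcn]
  have e2 : Complex.exp (c * ((2 * h : ℝ) : ℂ)) - Complex.exp (c * h) =
      Complex.exp (Complex.I * ((-(2 * Real.pi * j) * h : ℝ) : ℂ)) *
        (Complex.exp (Complex.I * ((-(2 * Real.pi * j) * h : ℝ) : ℂ)) - 1) := by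
    rw [mul_sub, ← Complex.exp_add, mul_one, hc]
    congr 2
    · push_cast
      ring
    · push_cast
      ring
  rw [e2, norm_mul, Complex.norm_exp_I_mul_ofReal, one_mul, Complex.norm_exp_I_mul_ofReal_sub_one,
    show -(2 * Real.pi * j) * h / 2 = -(Real.pi * j * h) by ring, Real.sin_neg, norm_mul,
    norm_neg, Real.norm_eq_abs, Real.norm_eq_abs, abs_two, mul_assoc 2 Real.pi,
    mul_div_mul_left _ _ two_ne_zero]

theorem norm_intervalIntegral_fourier_le {h : ℝ} (h0 : 0 < h) (j : ℤ) :
    ‖∫ t in h..(2 * h), (fourier (-j) (t : AddCircle (1 : ℝ)) : ℂ)‖ ≤ h := by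
  have := intervalIntegral.norm_integral_le_of_norm_le_const (a := h) (b := 2 * h) (C := 1)
    (f := fun t : ℝ => (fourier (-j) (t : AddCircle (1 : ℝ)) : ℂ)) fun t _ => by
      rw [fourier_apply, Circle.norm_coe]
  rwa [one_mul, two_mul, add_sub_cancel_right, abs_of_pos h0, ← two_mul] at this

/-- Decay in `j`, uniform in `h`: this is the useful bound when the arc is long compared with `1 /
j`. For short arcs the trivial bound `h` is better. -/
theorem norm_intervalIntegral_fourier_le_inv (h : ℝ) {j : ℤ} (hj : 0 < j) :
    ‖∫ t in h..(2 * h), (fourier (-j) (t : AddCircle (1 : ℝ)) : ℂ)‖ ≤ 1 / (Real.pi * j) := by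
  have hjr : (0 : ℝ) < j := by exact_mod_cast hj
  rw [norm_intervalIntegral_fourier hj]
  gcongr
  exact Real.abs_sin_le_one _

/-- Jordan's inequality `sin x ≥ 2x/π` on `[0, π/2]`; the condition `j * h ≤ 1 / 2` keeps `πjh` in
that range. -/
theorem le_norm_intervalIntegral_fourier {h : ℝ} (h0 : 0 < h) {j : ℤ} (hj : 0 < j)
    (hjh : j * h ≤ 1 / 2) :
    2 / Real.pi * h ≤ ‖∫ t in h..(2 * h), (fourier (-j) (t : AddCircle (1 : ℝ)) : ℂ)‖ := by
  have hjr : (0 : ℝ) < j := by exact_mod_cast hj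
  have hπ := Real.pi_pos
  rw [norm_intervalIntegral_fourier hj, le_div_iff₀ (by positivity)]
  refine le_trans ?_ (le_abs_self _)
  refine le_trans (le_of_eq ?_) (Real.mul_le_sin (by positivity) ?_)
  · ring
  · nlinarith

/-! ### The rapidly shrinking slabs and their `ℓ^p` span -/

/-- The `n`-th term of a very rapidly increasing sequence of block lengths. -/
def blockLength (M n : ℕ) : ℕ := M ^ (n + 1) ^ 2

/-- The length of the arc supporting the `n`-th basic function. -/
noncomputable def arcLength (M n : ℕ) : ℝ := (4 * (blockLength M n : ℝ))⁻¹

theorem blockLength_pos {M : ℕ} (hM : 0 < M) (n : ℕ) : 0 < blockLength M n := pow_pos hM _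

theorem arcLength_pos {M : ℕ} (hM : 0 < M) (n : ℕ) : 0 < arcLength M n := by
  have : (0 : ℝ) < blockLength M n := by exact_mod_cast blockLength_pos hM n
  rw [arcLength]
  positivity

theorem arcLength_mul_blockLength {M : ℕ} (hM : 0 < M) (n : ℕ) :
    arcLength M n * blockLength M n = 1 / 4 := by
  have : (0 : ℝ) < blockLength M n := by exact_mod_cast blockLength_pos hM n
  rw [arcLength]
  field_simp

theorem two_mul_arcLength_le_one {M : ℕ} (hM : 0 < M) (n : ℕ) : 2 * arcLength M n ≤ 1 := by
  have h1 : (1 : ℝ) ≤ blockLength M n := by exact_mod_cast blockLength_pos hM n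
  nlinarith [arcLength_mul_blockLength hM n, arcLength_pos hM n]

/-- The square in the exponent of `blockLength` is what matters: for `m < n`, `(n+1)² - (m+1)² =
(n-m)(n+m+2) ≥ (n+1)+(m+1)`. The ratio of the two lengths is thus bounded by a product of a factor
in `n` and a factor in `m`. -/
theorem arcLength_le_of_lt {M : ℕ} (hM : 0 < M) {m n : ℕ} (hmn : m < n) :
    arcLength M n ≤ arcLength M m * ((M : ℝ) ^ (n + 1 + (m + 1)))⁻¹ := by
  have h0 : (0 : ℝ) < blockLength M m := by exact_mod_cast blockLength_pos hM m
  have hMr : (0 : ℝ) < M := by exact_mod_cast hM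
  rw [arcLength, arcLength, ← mul_inv]
  refine inv_anti₀ (by positivity) ?_
  rw [mul_assoc]
  refine mul_le_mul_of_nonneg_left ?_ (by norm_num)
  simp only [blockLength]
  push_cast
  rw [← pow_add]
  refine pow_le_pow_right₀ (by exact_mod_cast hM) ?_
  nlinarith

theorem two_mul_blockLength_rpow_le {p q : ℝ} (hpq : p.HolderConjugate q) {M : ℕ}
    (hM : (4 : ℝ) ^ q ≤ M) (n : ℕ) :
    2 * (blockLength M n : ℝ) ^ (p - 1) ≤ (blockLength M (n + 1) : ℝ) ^ (p - 1) := by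
  have hp1 := hpq.lt
  have h1 : (1 : ℝ) ≤ M := (Real.one_le_rpow (by norm_num) hpq.symm.nonneg).trans hM
  have h2 : (M : ℝ) * blockLength M n ≤ blockLength M (n + 1) := by
    simp only [blockLength]
    push_cast
    rw [← pow_succ']
    exact pow_le_pow_right₀ h1 (Nat.pow_lt_pow_left (by omega) two_ne_zero)
  -- The threshold `4 ^ q` gives `M^(p-1) ≥ 4^(q(p-1)) = 4^p`, which is more than the required 2.
  have h3 : (2 : ℝ) ≤ (M : ℝ) ^ (p - 1) := by
    calc (2 : ℝ) ≤ 4 ^ p := by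
          have := Real.rpow_le_rpow_of_exponent_le (by norm_num : (1 : ℝ) ≤ 4) hp1.le
          rw [Real.rpow_one] at this
          linarith
      _ = (4 ^ q) ^ (p - 1) := by
          rw [← Real.rpow_mul (by norm_num), mul_comm, hpq.sub_one_mul_conj]
      _ ≤ _ := Real.rpow_le_rpow (by positivity) hM (by linarith)
  calc _ ≤ (M : ℝ) ^ (p - 1) * (blockLength M n : ℝ) ^ (p - 1) := by gcongr
    _ = ((M : ℝ) * blockLength M n) ^ (p - 1) := by
        rw [Real.mul_rpow (by positivity) (by positivity)]
    _ ≤ _ := Real.rpow_le_rpow (by positivity) h2 (by linarith)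

theorem arcLength_pairwise_disjoint {d : ℕ} (i : Fin d) {M : ℕ} (hM : 2 ≤ M) {m n : ℕ}
    (hmn : m ≠ n) : Disjoint (dyadicSlab i (arcLength M m)) (dyadicSlab i (arcLength M n)) := by
  have key : ∀ m n : ℕ, m < n →
      Disjoint (dyadicSlab i (arcLength M m)) (dyadicSlab i (arcLength M n)) := by
    intro m n h
    have h1 := arcLength_le_of_lt (by omega : 0 < M) h
    have h2 : ((M : ℝ) ^ (n + 1 + (m + 1)))⁻¹ ≤ 2⁻¹ := by
      refine inv_anti₀ (by norm_num) ?_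
      have hM' : (2 : ℝ) ≤ M := by exact_mod_cast hM
      calc (2 : ℝ) ≤ M ^ 1 := by simpa
        _ ≤ _ := pow_le_pow_right₀ (by linarith) (by omega)
    have h3 := mul_le_mul_of_nonneg_left h2 (arcLength_pos (by omega : 0 < M) m).le
    exact ((dyadicArc_disjoint (by linarith)).preimage (Function.eval i)).symm
  rcases hmn.lt_or_gt with h | h
  · exact key m n h
  · exact (key n m h).symm

/-- The normalized indicator functions, with disjoint supports shrinking very rapidly. -/
noncomputable def slabFun {d : ℕ} (i : Fin d) (p : ℝ) (M n : ℕ) :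
    Lp ℂ (ENNReal.ofReal p) (torusMeasure d) :=
  indicatorConstLp (ENNReal.ofReal p) (measurableSet_dyadicSlab i (arcLength M n))
    (measure_ne_top _ _) (((arcLength M n) ^ (-(1 / p)) : ℝ) : ℂ)

theorem enorm_sum_rpow_le_of_disjoint {T : Finset ℕ} {g : ℕ → ℂ} {p : ℝ} (hp : 0 < p)
    (hg : ∀ m n, m ≠ n → g m = 0 ∨ g n = 0) :
    ‖∑ n ∈ T, g n‖ₑ ^ p ≤ ∑ n ∈ T, ‖g n‖ₑ ^ p := by
  by_cases h : ∀ n ∈ T, g n = 0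
  · rw [Finset.sum_eq_zero h, enorm_zero, ENNReal.zero_rpow_of_pos hp]
    exact zero_le
  · push Not at h
    obtain ⟨n, hn, hgn⟩ := h
    rw [Finset.sum_eq_single n (fun m _ hm => (hg m n hm).resolve_right hgn)
      (fun h => absurd hn h)]
    exact Finset.single_le_sum (f := fun n => ‖g n‖ₑ ^ p) (fun _ _ => zero_le) hn

theorem coeFn_sum_smul_Lp {α : Type*} [MeasurableSpace α] {μ : Measure α} {r : ENNReal}
    (T : Finset ℕ) (a : ℕ → ℂ) (e : ℕ → Lp ℂ r μ) :
    (∑ n ∈ T, a n • e n : Lp ℂ r μ) =ᵐ[μ] fun x => ∑ n ∈ T, a n * e n x := by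
  induction T using Finset.induction_on with
  | empty =>
    simp only [Finset.sum_empty]
    exact Lp.coeFn_zero _ _ _
  | insert n T hn ih =>
    rw [Finset.sum_insert hn]
    filter_upwards [Lp.coeFn_add (a n • e n) (∑ n ∈ T, a n • e n), Lp.coeFn_smul (a n) (e n), ih]
      with x h1 h2 h3
    rw [h1, Pi.add_apply, h2, h3, Finset.sum_insert hn]
    rfl

/-- The supports are disjoint and each function has unit norm. Only the upper estimate is needed,
since the converse comes through the Fourier transform. -/
theorem norm_sum_smul_slabFun_le {d : ℕ} (i : Fin d) {p : ℝ} (hp : 0 < p) {M : ℕ} (hM : 2 ≤ M)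
    (T : Finset ℕ) (a : ℕ → ℂ) :
    ‖∑ n ∈ T, a n • slabFun i p M n‖ ≤ (∑ n ∈ T, ‖a n‖ ^ p) ^ (1 / p) := by
  have hM0 : 0 < M := by omega
  set c : ℕ → ℂ := fun n => (((arcLength M n) ^ (-(1 / p)) : ℝ) : ℂ) with hc
  set E : ℕ → Set (UnitAddTorus (Fin d)) := fun n => dyadicSlab i (arcLength M n) with hE
  have hEm : ∀ n, MeasurableSet (E n) := fun n => measurableSet_dyadicSlab i _
  have hae : (∑ n ∈ T, a n • slabFun i p M n : Lp ℂ (ENNReal.ofReal p) (torusMeasure d))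
      =ᵐ[torusMeasure d] fun x => ∑ n ∈ T, a n * (E n).indicator (fun _ => c n) x := by
    have h1 : ∀ᵐ x ∂(torusMeasure d), ∀ n, slabFun i p M n x = (E n).indicator (fun _ => c n) x :=
      ae_all_iff.2 fun n => indicatorConstLp_coeFn
    filter_upwards [coeFn_sum_smul_Lp T a (slabFun i p M), h1] with x hx hx1
    rw [hx]
    exact Finset.sum_congr rfl fun n _ => by rw [hx1 n]
  have hone : ∀ n, ‖c n‖ₑ ^ p * torusMeasure d (E n) = 1 := by
    intro n
    have h0 := arcLength_pos hM0 n
    rw [torusMeasure_dyadicSlab i h0 (two_mul_arcLength_le_one hM0 n), ← ofReal_norm, hc]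
    simp only
    rw [Complex.norm_real, Real.norm_of_nonneg (by positivity),
      ENNReal.ofReal_rpow_of_nonneg (by positivity) hp.le, ← Real.rpow_mul h0.le,
      neg_mul, one_div_mul_cancel hp.ne', Real.rpow_neg_one, ← ENNReal.ofReal_mul (by positivity),
      inv_mul_cancel₀ h0.ne', ENNReal.ofReal_one]
  have hint : ∫⁻ x, ‖(∑ n ∈ T, a n • slabFun i p M n :
      Lp ℂ (ENNReal.ofReal p) (torusMeasure d)) x‖ₑ ^ p ∂(torusMeasure d) ≤
      ENNReal.ofReal (∑ n ∈ T, ‖a n‖ ^ p) := by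
    calc _ = ∫⁻ x, ‖∑ n ∈ T, a n * (E n).indicator (fun _ => c n) x‖ₑ ^ p ∂(torusMeasure d) := by
          refine lintegral_congr_ae ?_
          filter_upwards [hae] with x hx
          rw [hx]
      _ ≤ ∫⁻ x, ∑ n ∈ T, (E n).indicator (fun _ => ‖a n‖ₑ ^ p * ‖c n‖ₑ ^ p) x
            ∂(torusMeasure d) := by
          refine lintegral_mono fun x => ?_
          refine (enorm_sum_rpow_le_of_disjoint hp fun m n hmn => ?_).trans (le_of_eq ?_)
          · by_cases hx : x ∈ E m
            · right
              rw [Set.indicator_of_notMem (Set.disjoint_left.1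
                (arcLength_pairwise_disjoint i hM hmn) hx), mul_zero]
            · left
              rw [Set.indicator_of_notMem hx, mul_zero]
          · refine Finset.sum_congr rfl fun n _ => ?_
            by_cases hx : x ∈ E n
            · simp [hx, ENNReal.mul_rpow_of_nonneg _ _ hp.le]
            · simp [hx, ENNReal.zero_rpow_of_pos hp]
      _ = ∑ n ∈ T, ‖a n‖ₑ ^ p := by
          rw [lintegral_finsetSum _ fun n _ => measurable_const.indicator (hEm n)]
          refine Finset.sum_congr rfl fun n _ => ?_
          rw [lintegral_indicator_const (hEm n), mul_assoc, hone, mul_one]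
      _ = _ := by
          rw [ENNReal.ofReal_sum_of_nonneg fun _ _ => by positivity]
          refine Finset.sum_congr rfl fun n _ => ?_
          rw [← ofReal_norm, ENNReal.ofReal_rpow_of_nonneg (norm_nonneg _) hp.le]
  rw [Lp.norm_def, ← lintegral_enorm_rpow_eq_eLpNorm hp]
  refine ENNReal.toReal_le_of_le_ofReal (by positivity) ?_
  rw [← ENNReal.ofReal_rpow_of_nonneg (by positivity) (by positivity)]
  exact ENNReal.rpow_le_rpow hint (by positivity)

/-! ### Fourier coefficients of the slab functions -/

theorem mFourierCoeff_slabFun {d : ℕ} (i : Fin d) (p : ℝ) {M : ℕ} (hM : 0 < M) (n : ℕ) (j : ℤ) :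
    mFourierCoeff (d := Fin d) (slabFun i p M n) (Pi.single i j) =
      (((arcLength M n) ^ (-(1 / p)) : ℝ) : ℂ) *
        ∫ t in (arcLength M n)..(2 * arcLength M n), (fourier (-j) (t : AddCircle (1 : ℝ)) : ℂ) := by
  rw [slabFun, mFourierCoeff_congr_ae indicatorConstLp_coeFn,
    mFourierCoeff_eq_integral_torusMeasure, ← setIntegral_dyadicSlab i (arcLength_pos hM n)
      (two_mul_arcLength_le_one hM n) (map_continuous _), ← integral_const_mul,
    ← integral_indicator (measurableSet_dyadicSlab i _)]
  refine integral_congr_ae (Filter.Eventually.of_forall fun x => ?_)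
  simp only
  rw [← Pi.single_neg, mFourier_single_apply]
  by_cases hx : x ∈ dyadicSlab i (arcLength M n)
  · simp [hx, mul_comm]
  · simp [hx]

theorem norm_mFourierCoeff_slabFun {d : ℕ} (i : Fin d) (p : ℝ) {M : ℕ} (hM : 0 < M) (n : ℕ)
    (j : ℤ) :
    ‖mFourierCoeff (d := Fin d) (slabFun i p M n) (Pi.single i j)‖ =
      (arcLength M n) ^ (-(1 / p)) *
        ‖∫ t in (arcLength M n)..(2 * arcLength M n),
          (fourier (-j) (t : AddCircle (1 : ℝ)) : ℂ)‖ := by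
  rw [mFourierCoeff_slabFun i p hM, norm_mul, Complex.norm_real,
    Real.norm_of_nonneg (Real.rpow_nonneg (arcLength_pos hM n).le _)]

theorem rpow_neg_inv_mul_self {p q : ℝ} (hpq : p.HolderConjugate q) {h : ℝ} (h0 : 0 < h) :
    h ^ (-(1 / p)) * h = h ^ (1 / q) := by
  rw [← Real.rpow_add_one h0.ne']
  congr 1
  have := hpq.inv_add_inv_eq_one
  simp only [one_div]
  linarith

/-- For `j ≤ 2 N_n`, `h_n N_n = 1 / 4` gives `j h_n ≤ 1 / 2`, so no oscillation cancels the
integral. -/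
theorem le_norm_mFourierCoeff_slabFun {d : ℕ} (i : Fin d) {p q : ℝ} (hpq : p.HolderConjugate q)
    {M : ℕ} (hM : 0 < M) (n : ℕ) {j : ℤ} (hj0 : (blockLength M n : ℤ) < j)
    (hj : j ≤ 2 * blockLength M n) :
    2 / Real.pi * (arcLength M n) ^ (1 / q) ≤
      ‖mFourierCoeff (d := Fin d) (slabFun i p M n) (Pi.single i j)‖ := by
  have h0 := arcLength_pos hM n
  have hj' : (j : ℝ) ≤ 2 * blockLength M n := by exact_mod_cast hj
  have h1 := le_norm_intervalIntegral_fourier h0 (j := j) (by omega)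
    (by nlinarith [arcLength_mul_blockLength hM n])
  rw [norm_mFourierCoeff_slabFun i p hM, ← rpow_neg_inv_mul_self hpq h0]
  calc _ = (arcLength M n) ^ (-(1 / p)) * (2 / Real.pi * arcLength M n) := by ring
    _ ≤ _ := by gcongr

theorem norm_mFourierCoeff_slabFun_le {d : ℕ} (i : Fin d) {p q : ℝ} (hpq : p.HolderConjugate q)
    (hp2 : p < 2) {M : ℕ} (hM : 0 < M) {m n : ℕ} (hmn : m ≠ n) {j : ℤ}
    (hj0 : (blockLength M n : ℤ) < j) :
    ‖mFourierCoeff (d := Fin d) (slabFun i p M m) (Pi.single i j)‖ ≤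
      2 / Real.pi * (arcLength M n) ^ (1 / q) * (2 * (((M : ℝ) ^ (-(1 / q))) ^ (n + 1) *
        ((M : ℝ) ^ (-(1 / q))) ^ (m + 1))) := by
  have hm0 := arcLength_pos hM m
  have hn0 := arcLength_pos hM n
  have hMr : (0 : ℝ) < M := by exact_mod_cast hM
  have hM1 : (1 : ℝ) ≤ M := by exact_mod_cast hM
  have hq0 := hpq.symm.pos
  have hπ := Real.pi_pos
  set δ : ℝ := ((M : ℝ) ^ (n + 1 + (m + 1)))⁻¹ with hδ
  have hδ0 : 0 < δ := by positivity
  have hδ1 : δ ≤ 1 := inv_le_one_of_one_le₀ (one_le_pow₀ hM1)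
  have hδq : ((M : ℝ) ^ (-(1 / q))) ^ (n + 1) * ((M : ℝ) ^ (-(1 / q))) ^ (m + 1) = δ ^ (1 / q) := by
    rw [← pow_add, hδ, Real.inv_rpow (by positivity), Real.rpow_neg hMr.le, inv_pow,
      Real.rpow_pow_comm hMr.le]
  rw [hδq, norm_mFourierCoeff_slabFun i p hM]
  rcases hmn.lt_or_gt with h | h
  -- Longer arc, `m < n`: oscillation beyond `N_n` bounds the integral by a multiple of `h_n`, and
  -- the smaller amplitude `h_m^(-1/p)` gains `δ^(1/p)`. Since `p < 2` and `δ ≤ 1`, this is at most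
  -- `δ^(1/q)`.
  · have hjN : (blockLength M n : ℝ) < j := by exact_mod_cast hj0
    have hN0 : (0 : ℝ) < blockLength M n := by exact_mod_cast blockLength_pos hM n
    have hle := arcLength_le_of_lt hM h
    have hpq' : 1 / q ≤ 1 / p := by
      have := hpq.inv_add_inv_eq_one
      have h2 : 2⁻¹ < p⁻¹ := inv_strictAnti₀ hpq.pos hp2
      simp only [one_div]
      norm_num at h2
      linarith
    have h1 : 1 / (Real.pi * j) ≤ 4 / Real.pi * arcLength M n := by
      calc 1 / (Real.pi * j) ≤ 1 / (Real.pi * blockLength M n) := by gcongr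
        _ = _ := by
          rw [arcLength]
          field_simp
    have h2 : (arcLength M m) ^ (-(1 / p)) ≤ (arcLength M n) ^ (-(1 / p)) * δ ^ (1 / p) := by
      rw [Real.rpow_neg hn0.le, Real.rpow_neg hm0.le, inv_mul_eq_div,
        inv_le_iff_one_le_mul₀ (by positivity), div_mul_eq_mul_div, one_le_div (by positivity),
        ← Real.mul_rpow hδ0.le hm0.le]
      refine Real.rpow_le_rpow hn0.le (by linarith) (one_div_nonneg.2 hpq.nonneg)
    calc _ ≤ ((arcLength M n) ^ (-(1 / p)) * δ ^ (1 / p)) * (4 / Real.pi * arcLength M n) := by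
          gcongr
          exact (norm_intervalIntegral_fourier_le_inv _ (by omega)).trans h1
      _ = 2 / Real.pi * ((arcLength M n) ^ (-(1 / p)) * arcLength M n) * (2 * δ ^ (1 / p)) := by
          ring
      _ ≤ _ := by
          rw [rpow_neg_inv_mul_self hpq hn0]
          have := Real.rpow_le_rpow_of_exponent_ge hδ0 hδ1 hpq'
          gcongr
  -- Shorter arc, `m > n`: the trivial bound gives `h_m^(1/q)`, already smaller than `h_n^(1/q)` by
  -- `δ^(1/q)`.
  · have hle := arcLength_le_of_lt hM h
    rw [add_comm (m + 1), ← hδ] at hle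
    calc _ ≤ (arcLength M m) ^ (-(1 / p)) * arcLength M m := by
          gcongr
          exact norm_intervalIntegral_fourier_le hm0 j
      _ = (arcLength M m) ^ (1 / q) := rpow_neg_inv_mul_self hpq hm0
      _ ≤ (arcLength M n * δ) ^ (1 / q) := Real.rpow_le_rpow hm0.le hle (by positivity)
      _ = 1 * ((arcLength M n) ^ (1 / q) * δ ^ (1 / q)) := by
          rw [one_mul, Real.mul_rpow hn0.le hδ0.le]
      _ ≤ 4 / Real.pi * ((arcLength M n) ^ (1 / q) * δ ^ (1 / q)) := by
          gcongr
          rw [one_le_div hπ]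
          exact Real.pi_le_four
      _ = _ := by ring

/-- On the block of frequencies attached to `n`, the `n`-th summand dominates the Fourier
coefficients of a linear combination of the functions `slabFun`. -/
theorem le_norm_sum_mFourierCoeff_slabFun {d : ℕ} (i : Fin d) {p q : ℝ}
    (hpq : p.HolderConjugate q) (hp2 : p < 2) {M : ℕ} (hM : 0 < M) {T : Finset ℕ} (a : ℕ → ℂ)
    {n : ℕ} (hn : n ∈ T) {j : ℤ} (hj0 : (blockLength M n : ℤ) < j)
    (hj : j ≤ 2 * blockLength M n) :
    2 / Real.pi * (arcLength M n) ^ (1 / q) * max 0 (‖a n‖ - 2 * ∑ m ∈ T.erase n,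
        ((M : ℝ) ^ (-(1 / q))) ^ (n + 1) * ((M : ℝ) ^ (-(1 / q))) ^ (m + 1) * ‖a m‖) ≤
      ‖∑ m ∈ T, a m * mFourierCoeff (d := Fin d) (slabFun i p M m) (Pi.single i j)‖ := by
  have hκ : 0 ≤ 2 / Real.pi * (arcLength M n) ^ (1 / q) :=
    mul_nonneg (div_nonneg zero_le_two Real.pi_pos.le) (Real.rpow_nonneg (arcLength_pos hM n).le _)
  rw [mul_max_of_nonneg _ _ hκ, mul_zero]
  refine max_le (norm_nonneg _) ?_
  rw [← Finset.add_sum_erase T _ hn]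
  refine le_trans ?_ (norm_sub_le_norm_add _ _)
  rw [mul_sub]
  refine sub_le_sub ?_ ?_
  · rw [norm_mul, mul_comm]
    exact mul_le_mul_of_nonneg_left (le_norm_mFourierCoeff_slabFun i hpq hM n hj0 hj)
      (norm_nonneg _)
  · refine (norm_sum_le _ _).trans ?_
    rw [Finset.mul_sum, Finset.mul_sum]
    refine Finset.sum_le_sum fun m hm => ?_
    rw [norm_mul]
    refine (mul_le_mul_of_nonneg_left (norm_mFourierCoeff_slabFun_le i hpq hp2 hM
      (Finset.ne_of_mem_erase hm) hj0) (norm_nonneg _)).trans (le_of_eq ?_)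
    ring

/-! ### The transform is bounded below on the span -/

theorem sum_rpow_le_norm_fourierLorentz {d : ℕ} (i : Fin d) {p q : ℝ} (hp1 : 1 < p)
    (hp2 : p < 2) (hpq : p.HolderConjugate q) {M : ℕ} (hM : (4 : ℝ) ^ q ≤ M) :
    ∃ K : ℝ, 0 < K ∧ ∀ (T : Finset ℕ) (a : ℕ → ℂ),
      (∑ n ∈ T, ‖a n‖ ^ p) ^ (1 / p) ≤
        K * ‖fourierLorentz d hp1 hp2 hpq (∑ n ∈ T, a n • slabFun i p M n)‖ := by
  have hp0 := hpq.pos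
  have hq0 := hpq.symm.pos
  have hπ := Real.pi_pos
  have hpq' : p / q = p - 1 := by
    rw [div_eq_iff hpq.symm.ne_zero, hpq.sub_one_mul_conj]
  have hMr : (0 : ℝ) < M := (Real.rpow_pos_of_pos (by norm_num) q).trans_le hM
  have hM0 : 0 < M := by exact_mod_cast hMr
  set ε : ℝ := (M : ℝ) ^ (-(1 / q)) with hε
  have hε0 : 0 ≤ ε := Real.rpow_nonneg hMr.le _
  -- The choice `M ≥ 4 ^ q` is exactly what brings `ε` down to the `1 / 4` of the perturbation
  -- lemma.
  have hε4 : ε ≤ 1 / 4 := by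
    rw [hε, Real.rpow_neg hMr.le, one_div 4]
    refine inv_anti₀ (by norm_num) ?_
    calc (4 : ℝ) = (4 ^ q) ^ (1 / q) := by
          rw [← Real.rpow_mul (by norm_num), mul_one_div_cancel hq0.ne', Real.rpow_one]
      _ ≤ _ := Real.rpow_le_rpow (by positivity) hM (by positivity)
  set κ : ℝ := (2 / Real.pi) ^ p * (1 / 4) ^ (p - 1) with hκ
  have hκ0 : 0 < κ := by positivity
  refine ⟨(4 * (2 * p) / κ) ^ (1 / p) * (q ^ (1 / p))⁻¹, by positivity, fun T a => ?_⟩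
  set z := ∑ n ∈ T, a n • slabFun i p M n with hz
  set u : (Fin d → ℤ) → ℂ := (fourierLorentz d hp1 hp2 hpq z : (Fin d → ℤ) → ℂ) with hu
  set x : ℕ → ℝ := fun n => max 0 (‖a n‖ - 2 * ∑ m ∈ T.erase n,
    ε ^ (n + 1) * ε ^ (m + 1) * ‖a m‖) with hx
  have hx0 : ∀ n, 0 ≤ x n := fun n => le_max_left _ _
  set v : ℕ → ℝ := fun n => 2 / Real.pi * (arcLength M n) ^ (1 / q) * x n with hv
  have hv0 : ∀ n, 0 ≤ v n := fun n => mul_nonneg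
    (mul_nonneg (by positivity) (Real.rpow_nonneg (arcLength_pos hM0 n).le _)) (hx0 n)
  set I : ENNReal := ∫⁻ t in Set.Ioi (0 : ℝ), ENNReal.ofReal (t ^ (p - 1)) *
    (Measure.count : Measure (Fin d → ℤ)) {k | t < ‖u k‖} ^ (p - 1) with hI
  have hIfin : I ≠ ⊤ := by
    have hmem : eLorentzNorm u q p Measure.count < ⊤ := (fourierLorentz d hp1 hp2 hpq z).2
    rw [eLorentzNorm_lt_top_iff u hq0 hp0, hpq'] at hmem
    exact hmem.ne
  have hnorm : ‖fourierLorentz d hp1 hp2 hpq z‖ = q ^ (1 / p) * I.toReal ^ (1 / p) := by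
    change (eLorentzNorm u q p Measure.count).toReal = _
    rw [eLorentzNorm, hpq', ENNReal.toReal_mul, ENNReal.toReal_ofReal (by positivity),
      ← ENNReal.toReal_rpow]
  have hsum : ∀ k, u k = ∑ n ∈ T, a n * mFourierCoeff (d := Fin d) (slabFun i p M n) k := by
    intro k
    have h1 : fourierLorentz d hp1 hp2 hpq z =
        ∑ n ∈ T, a n • fourierLorentz d hp1 hp2 hpq (slabFun i p M n) := by
      rw [hz, map_sum]
      exact Finset.sum_congr rfl fun n _ => map_smul _ _ _
    rw [hu, h1, Submodule.coe_sum, Finset.sum_apply]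
    rfl
  have hblock := sum_block_le_lintegral hp1 (two_mul_blockLength_rpow_le hpq hM) (T := T)
    (B := fun n => (Finset.Ioc (blockLength M n : ℤ) (2 * blockLength M n)).map
      ⟨Pi.single i, Pi.single_injective i⟩) (u := u) (v := v)
    (fun n => by rw [Finset.card_map, Int.card_Ioc]; omega) hv0 (by
      intro n hn k hk
      obtain ⟨j, hj, rfl⟩ := Finset.mem_map.1 hk
      rw [Finset.mem_Ioc] at hj
      rw [hsum]
      exact le_norm_sum_mFourierCoeff_slabFun i hpq hp2 hM0 a hn hj.1 hj.2)
  -- The scale disappears: `(h_n^(1/q))^p = h_n^(p-1)`, and `h_n N_n = 1 / 4`.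
  have hterm : ∀ n, (blockLength M n : ℝ) ^ (p - 1) * v n ^ p = κ * x n ^ p := by
    intro n
    have h0 := arcLength_pos hM0 n
    have hN0 : (0 : ℝ) ≤ blockLength M n := Nat.cast_nonneg _
    simp only [hv]
    rw [Real.mul_rpow (by positivity) (hx0 n), Real.mul_rpow (by positivity) (by positivity),
      ← Real.rpow_mul h0.le, one_div_mul_eq_div, hpq', hκ, ← arcLength_mul_blockLength hM0 n,
      Real.mul_rpow h0.le hN0]
    ring
  rw [Finset.sum_congr rfl fun n _ => hterm n, ← Finset.mul_sum, ← hI] at hblock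
  have hreal : κ * ∑ n ∈ T, x n ^ p ≤ 2 * p * I.toReal := by
    have h := ENNReal.toReal_mono (ENNReal.mul_ne_top ENNReal.ofReal_ne_top hIfin) hblock
    rwa [ENNReal.toReal_mul, ENNReal.toReal_ofReal (by positivity : 0 ≤ 2 * p),
      ENNReal.toReal_ofReal (mul_nonneg hκ0.le
        (Finset.sum_nonneg fun n _ => Real.rpow_nonneg (hx0 n) _))] at h
  have hpert := sum_rpow_le_four_mul_sum_perturb hp1.le hp2.le hε0 hε4 T
    (a := fun n => ‖a n‖) fun n => norm_nonneg _
  have hfinal : ∑ n ∈ T, ‖a n‖ ^ p ≤ 4 * (2 * p) / κ * I.toReal := by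
    refine hpert.trans ?_
    rw [mul_div_assoc, mul_assoc, div_mul_eq_mul_div]
    refine mul_le_mul_of_nonneg_left ?_ (by norm_num)
    rw [le_div_iff₀ hκ0, mul_comm]
    exact hreal
  rw [hnorm]
  calc _ ≤ (4 * (2 * p) / κ * I.toReal) ^ (1 / p) :=
        Real.rpow_le_rpow (by positivity) hfinal (by positivity)
    _ = (4 * (2 * p) / κ) ^ (1 / p) * I.toReal ^ (1 / p) :=
        Real.mul_rpow (by positivity) ENNReal.toReal_nonneg
    _ = _ := by
        have : q ^ (1 / p) ≠ 0 := by positivity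
        field_simp

/-- For `z = ∑ a n • slabFun i p M n` the chain `‖z‖ ≤ ‖a‖_p ≤ K ‖F z‖ ≤ K C ‖z‖` closes up, so all
these quantities are equivalent on the span. -/
theorem not_isStrictlySingular_fourierLorentz {d : ℕ} (hd : 1 ≤ d) {p q : ℝ} (hp1 : 1 < p)
    (hp2 : p < 2) (hpq : p.HolderConjugate q) :
    ¬ IsStrictlySingular (fourierLorentz d hp1 hp2 hpq) := by
  have hp0 := hpq.pos
  -- Here `d ≥ 1` enters: the slabs need a coordinate direction.
  have i : Fin d := ⟨0, hd⟩
  obtain ⟨M, hM⟩ := exists_nat_ge ((4 : ℝ) ^ q)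
  have hM2 : 2 ≤ M := by
    have h1 : (4 : ℝ) ^ (1 : ℝ) ≤ 4 ^ q :=
      Real.rpow_le_rpow_of_exponent_le (by norm_num) hpq.symm.lt.le
    rw [Real.rpow_one] at h1
    have h2 : (2 : ℝ) ≤ M := by linarith
    exact_mod_cast h2
  obtain ⟨K, hK0, hK⟩ := sum_rpow_le_norm_fourierLorentz i hp1 hp2 hpq hM
  obtain ⟨C, hC⟩ := isBoundedOperator_fourierLorentz d hp1 hp2 hpq
  set L := Finsupp.linearCombination ℂ (slabFun i p M) with hL
  have hLa : ∀ a : ℕ →₀ ℂ, L a = ∑ n ∈ a.support, a n • slabFun i p M n := fun a => by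
    rw [hL, Finsupp.linearCombination_apply, Finsupp.sum]
  have hinj : Function.Injective L := by
    rw [← LinearMap.ker_eq_bot, LinearMap.ker_eq_bot']
    intro a ha
    have h1 := hK a.support a
    -- The target carries a bare `Norm`, so the vanishing of the norm at `0` is drawn from
    -- boundedness.
    have h0 : ‖fourierLorentz d hp1 hp2 hpq 0‖ ≤ 0 := by
      refine (hC 0).trans (le_of_eq ?_)
      rw [Lp.norm_zero, mul_zero]
    rw [← hLa, ha] at h1
    have h2 : (∑ n ∈ a.support, ‖a n‖ ^ p) ^ (1 / p) ≤ 0 :=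
      h1.trans (mul_nonpos_of_nonneg_of_nonpos hK0.le h0)
    have hS : 0 ≤ ∑ n ∈ a.support, ‖a n‖ ^ p :=
      Finset.sum_nonneg fun _ _ => Real.rpow_nonneg (norm_nonneg _) _
    have h3 := (Real.rpow_eq_zero hS (one_div_pos.2 hp0).ne').1
      (le_antisymm h2 (Real.rpow_nonneg hS _))
    rw [Finset.sum_eq_zero_iff_of_nonneg fun _ _ => Real.rpow_nonneg (norm_nonneg _) _] at h3
    ext n
    by_contra hn
    have h4 := h3 n (Finsupp.mem_support_iff.2 hn)
    rw [Real.rpow_eq_zero (norm_nonneg _) hp0.ne', norm_eq_zero] at h4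
    exact hn h4
  rw [IsStrictlySingular, not_not]
  -- The constant `C` from boundedness has no known sign; `max C 1` is positive.
  refine ⟨LinearMap.range L, fun hfin => ?_, K⁻¹, max C 1, inv_pos.2 hK0, by positivity, ?_⟩
  · have e := LinearEquiv.ofInjective L hinj
    have : FiniteDimensional ℂ (ℕ →₀ ℂ) := Module.Finite.equiv e.symm
    exact not_finite_iff_infinite.2 inferInstance
      (Module.finite_finsupp_self_iff.1 this |>.resolve_left (not_subsingleton ℂ))
  · rintro z ⟨a, rfl⟩
    refine ⟨?_, (hC _).trans (mul_le_mul_of_nonneg_right (le_max_left _ _) ?_)⟩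
    · rw [inv_mul_le_iff₀ hK0, hLa]
      exact (norm_sum_smul_slabFun_le i hp0 hM2 a.support a).trans (hK a.support a)
    · exact ENNReal.toReal_nonneg

theorem mainTheorem6 (d : ℕ) (hd : 1 ≤ d) (p q : ℝ) (hp1 : 1 < p) (hp2 : p < 2)
    (hpq : p.HolderConjugate q) :
    ∃ F : Lp ℂ (ENNReal.ofReal p) (torusMeasure d) →ₗ[ℂ]
        lorentzSeq (Fin d → ℤ) q p hpq.symm.pos hpq.pos,
      (∀ f k, (F f : (Fin d → ℤ) → ℂ) k = UnitAddTorus.mFourierCoeff f k) ∧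
      IsBoundedOperator F ∧ ¬ IsStrictlySingular F :=
  ⟨fourierLorentz d hp1 hp2 hpq, fun _ _ => rfl, isBoundedOperator_fourierLorentz d hp1 hp2 hpq,
    not_isStrictlySingular_fourierLorentz hd hp1 hp2 hpq⟩
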